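/- Let $n\ge 1$ and let $F$ be a germ of holomorphic diffeomorphism of $\mathbb C^n$ fixing $0$, whose differential $dF_0$ is diagonalizable with eigenvalues $\lambda_1,\dots,\lambda_n$. For $z\in\mathbb C^n$ and $l\in\mathbb N^n$ write $z^l=z_1^{l_1}\cdots z_n^{l_n}$ and $|l|=l_1+\dots+l_n$. Assume that for some $1\le m\le n$ the germ $F$ is *one-resonant with respect to* $\{\lambda_1,\dots,\lambda_m\}$: there is a multi-index $\alpha=(\alpha_1,\dots,\alpha_m,0,\dots,0)\neq 0$ in $\mathbb N^n$ such that, for $1\le j\le m$ and $l\in\mathbb N^n$, one has $|l|\ge 2$ and $\lambda_j=\lambda^l$ if and only if $l=s\alpha+e_j$ for some integer $s\ge 1$. Assume that in suitable local holomorphic coordinates at $0$ the differential of $F$ is $\mathrm{diag}(\lambda_1,\dots,\lambda_n)$ and $$F_j(z)=\lambda_jz_j+a_jz^{k\alpha}z_j+O(|z|^{k|\alpha|+2}),\qquad j=1,\dots,m,$$ with $k\ge 1$ and $(a_1,\dots,a_m)\ne 0$ (so that $k$ is the *order* of $F$ with respect to $\{\lambda_1,\dots,\lambda_m\}$). Put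 $\Lambda=\sum_{j=1}^m a_j\alpha_j/\lambda_j$. Assume that $F$ is *non-degenerate*, that is $\Lambda\neq0$, and *parabolically attracting*, that is $$|\lambda_j|=1\quad\text{and}\quad \operatorname{Re}\bigl(a_j\lambda_j^{-1}\Lambda^{-1}\bigr)>0,\qquad j=1,\dots,m,$$ and that $|\lambda_j|<1$ for $j>m$. A *basin of attraction* for $F$ at $0$ is a nonempty open set $U\subset\mathbb C^n$ with $0\in\overline U$ for which there is a neighborhood basis $\{\Omega_i\}$ of $0$ such that, for every $i$, $F(U\cap\Omega_i)\subset U\cap\Omega_i$ and $F^{\circ q}(z)\to0$ as $q\to\infty$ for all $z\in U\cap\Omega_i$. Then there are $k$ pairwise disjoint basins of attraction $B_1,\dots,B_k$ for $F$ at $0$, each with $0\in\partial B_j$. They can be chosen to be built over sectors in the $k$ petals of the germ induced by $F$ on $u=z^\alpha$, in the following sense. There are local holomorphic coordinates $z$ at $0$ in which $F$ becomes a germ $G$ of the form above, with the same $k$ and $a_1,\dots,a_m$; a germ $h(u)=u+\Lambda u^{k+1}+O(|u|^{k+2})$ of holomorphic map at $0\in\mathbb C$; and numbers $\beta,\delta,\varepsilon>0$,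 $N\in\mathbb N$ with $\beta|\alpha|<1$ and $\beta N>k+1$, such that $G(z)^\alpha=h(z^\alpha)+O(|z|^N)$ and the following holds. Let $v_1,\dots,v_k$ be the $k$-th roots of $-|\Lambda|/\Lambda$ and let $$S_j=\{u\in\mathbb C:\ |\Lambda u^k+\delta|<\delta,\ |\operatorname{Arg}(u/v_j)|<\varepsilon\}.$$ Then $S_j$ is contained in an attracting petal $P_j$ for $h$ centered at $v_j$, and in the coordinates $z$ $$B_j=\{z:\ u=z^\alpha\in S_j,\ |z_i|<|u|^\beta\ \text{for } i=1,\dots,n\}.$$ Here an attracting petal for $h$ centered at $v$ is a simply connected domain $P$ on which $h$ is holomorphic, with $0\in\partial P$ and $h(P)\subset P$, such that for all $u\in P$ one has $h^{\circ q}(u)\to0$, $h^{\circ q}(u)\ne0$ for all $q$, and $h^{\circ q}(u)/|h^{\circ q}(u)|\to v$. -/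

import Mathlib

open Filter Topology Asymptotics

namespace OneRes

/-- `F` represents a germ at `0` of holomorphic diffeomorphism of `ℂⁿ` fixing `0`. -/
structure IsGermDiffeo {n : ℕ} (F : (Fin n → ℂ) → (Fin n → ℂ)) : Prop where
  analytic : AnalyticAt ℂ F 0
  map_zero : F 0 = 0
  invertible : (fderiv ℂ F 0).IsInvertible

/-- The monomial `z ^ α = z₁ ^ α₁ ⋯ zₙ ^ αₙ`. -/
def mon {n : ℕ} (α : Fin n → ℕ) (z : Fin n → ℂ) : ℂ := ∏ i, z i ^ α i

/-- The differential of `F` at `0` is diagonalizable, and its eigenvalues, repeated according to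
multiplicity, are `lam 0, …, lam (n - 1)`. -/
def HasEigenvalues {n : ℕ} (F : (Fin n → ℂ) → (Fin n → ℂ)) (lam : Fin n → ℂ) : Prop :=
  ∃ b : Module.Basis (Fin n) ℂ (Fin n → ℂ), ∀ i, fderiv ℂ F 0 (b i) = lam i • b i

/-- `(j, l)` is a resonance of `lam`: the multi-index `l` has `|l| ≥ 2` and `λ_j = λ ^ l`. -/
def IsResonance {n : ℕ} (lam : Fin n → ℂ) (j : Fin n) (l : Fin n → ℕ) : Prop :=
  2 ≤ ∑ i, l i ∧ lam j = mon l lam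

/-- `F` is one-resonant with respect to the first `m` of the eigenvalues `lam` of its
differential, with index of resonance `α`: the resonances `(j, l)` with `j` among the first `m`
indices are precisely those with `l = s α + e_j`, `s ≥ 1`. -/
structure IsOneResonant {n : ℕ} (F : (Fin n → ℂ) → (Fin n → ℂ)) (lam : Fin n → ℂ)
    (m : ℕ) (α : Fin n → ℕ) : Prop where
  eigenvalues : HasEigenvalues F lam
  one_le : 1 ≤ m
  le_dim : m ≤ n
  index_ne_zero : α ≠ 0
  index_supp : ∀ j : Fin n, m ≤ (j : ℕ) → α j = 0
  resonance_iff : ∀ j : Fin n, (j : ℕ) < m → ∀ l : Fin n → ℕ,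
    IsResonance lam j l ↔ ∃ s : ℕ, 1 ≤ s ∧ l = s • α + Pi.single j 1

/-- `φ` is a germ of holomorphic change of coordinates which conjugates `F` to `G`, that is
`G = φ⁻¹ ∘ F ∘ φ` as germs at `0`. -/
structure Conjugates {n : ℕ} (φ F G : (Fin n → ℂ) → (Fin n → ℂ)) : Prop where
  diffeo : IsGermDiffeo φ
  conj : ∀ᶠ z in 𝓝 (0 : Fin n → ℂ), F (φ z) = φ (G z)

/-- `G` has diagonal differential `diag lam`, and its first `m` components are
`G_j(z) = λ_j z_j + a_j z^{kα} z_j + O(|z|^{k|α|+2})`, with `k ≥ 1` and `(a_1, …, a_m) ≠ 0`.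
(The entries of `a` after the `m`-th play no role.) -/
structure IsLeadingForm {n : ℕ} (G : (Fin n → ℂ) → (Fin n → ℂ)) (lam : Fin n → ℂ)
    (m : ℕ) (α : Fin n → ℕ) (k : ℕ) (a : Fin n → ℂ) : Prop where
  diffeo : IsGermDiffeo G
  diagonal : ∀ (z : Fin n → ℂ) (i : Fin n), fderiv ℂ G 0 z i = lam i * z i
  one_le : 1 ≤ k
  coeff_ne_zero : ∃ j : Fin n, (j : ℕ) < m ∧ a j ≠ 0
  expansion : ∀ j : Fin n, (j : ℕ) < m →
    (fun z : Fin n → ℂ => G z j - (lam j * z j + a j * mon α z ^ k * z j))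
      =O[𝓝 0] fun z => ‖z‖ ^ ((∑ i, α i) * k + 2)

/-- `k` is the order of `F` with respect to the first `m` eigenvalues, and `a` is the vector of
leading coefficients of `F` in suitable holomorphic coordinates. -/
def HasOrder {n : ℕ} (F : (Fin n → ℂ) → (Fin n → ℂ)) (lam : Fin n → ℂ)
    (m : ℕ) (α : Fin n → ℕ) (k : ℕ) (a : Fin n → ℂ) : Prop :=
  ∃ φ G : (Fin n → ℂ) → (Fin n → ℂ), Conjugates φ F G ∧ IsLeadingForm G lam m α k a

/-- The number `Λ = ∑_{j ≤ m} a_j α_j / λ_j`. -/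
noncomputable def bigLam {n : ℕ} (lam : Fin n → ℂ) (m : ℕ) (α : Fin n → ℕ)
    (a : Fin n → ℂ) : ℂ :=
  ∑ j : Fin n, if (j : ℕ) < m then a j * (α j : ℂ) / lam j else 0

/-- The condition of parabolic attraction, in terms of the leading coefficients `a`. -/
def IsParabolicallyAttracting {n : ℕ} (lam : Fin n → ℂ) (m : ℕ) (α : Fin n → ℕ)
    (a : Fin n → ℂ) : Prop :=
  ∀ j : Fin n, (j : ℕ) < m →
    ‖lam j‖ = 1 ∧ 0 < (a j * (lam j)⁻¹ * (bigLam lam m α a)⁻¹).re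

/-- `U` is a basin of attraction for `F` at `0`. -/
structure IsBasin {n : ℕ} (F : (Fin n → ℂ) → (Fin n → ℂ)) (U : Set (Fin n → ℂ)) : Prop where
  isOpen : IsOpen U
  nonempty : U.Nonempty
  zero_mem_closure : (0 : Fin n → ℂ) ∈ closure U
  exists_basis : ∃ 𝒪 : Set (Set (Fin n → ℂ)),
    (𝓝 (0 : Fin n → ℂ)).HasBasis (fun Ω => Ω ∈ 𝒪) id ∧
    ∀ Ω ∈ 𝒪, Set.MapsTo F (U ∩ Ω) (U ∩ Ω) ∧
      ∀ z ∈ U ∩ Ω, Tendsto (fun q : ℕ => F^[q] z) atTop (𝓝 0)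

/-- `P` is an attracting petal, centered at the direction `v`, for the germ `h` at `0` of
holomorphic self-map of `ℂ`. -/
structure IsAttractingPetal (h : ℂ → ℂ) (v : ℂ) (P : Set ℂ) : Prop where
  isOpen : IsOpen P
  simplyConnected : SimplyConnectedSpace P
  zero_mem_frontier : (0 : ℂ) ∈ frontier P
  analytic : AnalyticOnNhd ℂ h P
  mapsTo : Set.MapsTo h P P
  tendsto_zero : ∀ u ∈ P, Tendsto (fun q : ℕ => h^[q] u) atTop (𝓝 0)
  iterate_ne_zero : ∀ u ∈ P, ∀ q : ℕ, h^[q] u ≠ 0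
  tendsto_direction : ∀ u ∈ P,
    Tendsto (fun q : ℕ => h^[q] u / (‖h^[q] u‖ : ℂ)) atTop (𝓝 v)

/-- The sector `{u : |A u^k + δ| < δ, |Arg (u / v)| < ε}` around the direction `v`. -/
def petalSector (A : ℂ) (k : ℕ) (δ ε : ℝ) (v : ℂ) : Set ℂ :=
  {u | ‖A * u ^ k + (δ : ℂ)‖ < δ ∧ |(u / v).arg| < ε}

/-- The set `{z : u = z^α ∈ S, |z_i| < |u|^β for all i}` over `S ⊆ ℂ`. -/
def basinOver {n : ℕ} (α : Fin n → ℕ) (β : ℝ) (S : Set ℂ) : Set (Fin n → ℂ) :=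
  {z | mon α z ∈ S ∧ ∀ i, ‖z i‖ < ‖mon α z‖ ^ β}

/-- The sets `B j` are built over sectors in the `k` petals of the germ
`h(u) = u + Λ u^{k+1} + O(|u|^{k+2})` which `F` induces on `u = z^α`.
Here `φ` is a holomorphic chart on the open set `W ∋ 0` in which `F` becomes `G`, and `h` is
induced by `G` in the sense that `G(z)^α = h(z^α) + O(|z|^N)`, where `N β > k + 1`, so that
the error term is `o(|u|^{k+1})` on the sets `basinOver α β S`. -/
def BuiltOverPetals {n : ℕ} (F : (Fin n → ℂ) → (Fin n → ℂ)) (lam : Fin n → ℂ)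
    (m : ℕ) (α : Fin n → ℕ) (k : ℕ) (a : Fin n → ℂ) (B : Fin k → Set (Fin n → ℂ)) : Prop :=
  ∃ (φ G : (Fin n → ℂ) → (Fin n → ℂ)) (W : Set (Fin n → ℂ)) (h : ℂ → ℂ) (N : ℕ)
    (β δ ε : ℝ) (v : Fin k → ℂ) (P : Fin k → Set ℂ),
    Conjugates φ F G ∧ IsLeadingForm G lam m α k a ∧
    IsOpen W ∧ (0 : Fin n → ℂ) ∈ W ∧ AnalyticOnNhd ℂ φ W ∧ Set.InjOn φ W ∧
    AnalyticAt ℂ h 0 ∧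
    (fun u : ℂ => h u - (u + bigLam lam m α a * u ^ (k + 1))) =O[𝓝 0]
      (fun u => ‖u‖ ^ (k + 2)) ∧
    (fun z : Fin n → ℂ => mon α (G z) - h (mon α z)) =O[𝓝 0] (fun z => ‖z‖ ^ N) ∧
    0 < β ∧ β * (∑ i, α i : ℕ) < 1 ∧ (k : ℝ) + 1 < β * N ∧
    0 < δ ∧ 0 < ε ∧
    Function.Injective v ∧
    (∀ j, v j ^ k = -((‖bigLam lam m α a‖ : ℂ) / bigLam lam m α a)) ∧
    (∀ j, IsAttractingPetal h (v j) (P j)) ∧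
    (∀ j, petalSector (bigLam lam m α a) k δ ε (v j) ⊆ P j) ∧
    (∀ j, basinOver α β (petalSector (bigLam lam m α a) k δ ε (v j)) ⊆ W) ∧
    (∀ j, B j = φ '' basinOver α β (petalSector (bigLam lam m α a) k δ ε (v j)))

end OneRes

/-! The first m components of F are brought to Poincaré–Dulac normal form up to an arbitrary finite
order N (`exists_normal`). One-resonance leaves only the monomials `z ^ (sα) z_j`, so G_j(z) = z_j
(λ_j + a_j u^k + u^(k+1) p_j(u)) + O(|z|^N) with u = z^α. Only finitely many nonresonant terms are
removed, so no small divisor estimate is needed. Multiplying the components, u evolves under h(u) =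
u ∏ (λ_j + a_j u^k + ...)^(α_j), up to O(|z|^N). Since λ^α = 1, h(u) = u + Λ u^(k+1) + ...
(`inducedGerm_expansion`).

On the region |z_i| < |u|^β with βN > k + 1 the error is o(|u|^(k+1)). In the coordinate w = -1/(Λ
u^k) one step is then w ↦ w + k + o(1), which preserves narrow cones around the positive real axis
far to the right. Pulled back by the k branches of the k-th root, these cones are the sectors
(`exists_sector_step`, `exists_isAttractingPetal`).

The conditions |z_j| < |u|^β must also persist (`exists_basin_step`). For j > m this follows from
|λ_j| < 1. For j ≤ m put b_j = a_j/(λ_j Λ). To first order |z_j| is multiplied by 1 + Re(b_j Λ u^k)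
and |u|^β by 1 + β Re(Λ u^k), where Λ u^k = -1/w has negative real part. Parabolic attraction, Re
b_j > 0, makes the first factor smaller once β and the aperture are small (`re_mul_le_of_mem_cone`).
Orbits then satisfy |z| ≤ |u|^β with u → 0. The condition β|α| < 1 ensures that these sets
accumulate at 0. -/

namespace OneRes

/-! ### Normal form of finite order -/

section

variable {n : ℕ}

/-- Taylor terms of degree d are multilinear, so they come indexed by words `r : Fin d → Fin n`;
counting letters turns a word into the multi-index that the resonance condition speaks of. -/
lemma mon_eq_prod_comp {d : ℕ} (r : Fin d → Fin n) (z : Fin n → ℂ) :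
    ∏ t, z (r t) = mon (fun i => (Finset.univ.filter fun t => r t = i).card) z := by
  unfold mon
  rw [← Finset.prod_fiberwise Finset.univ r]
  refine Finset.prod_congr rfl fun i _ => ?_
  rw [Finset.prod_congr rfl (g := fun _ => z i), Finset.prod_const]
  intro t ht
  rw [(Finset.mem_filter.mp ht).2]

lemma mon_add_single (α : Fin n → ℕ) (s : ℕ) (j : Fin n) (z : Fin n → ℂ) :
    mon (s • α + Pi.single j 1) z = mon α z ^ s * z j := by
  unfold mon
  simp only [Pi.add_apply, Pi.smul_apply, smul_eq_mul, pow_add, Finset.prod_mul_distrib,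
    ← Finset.prod_pow]
  congr 1
  · exact Finset.prod_congr rfl fun i _ => by rw [← pow_mul, mul_comm]
  · rw [Finset.prod_eq_single j] <;> simp +contextual

lemma analyticAt_apply (i : Fin n) (z₀ : Fin n → ℂ) :
    AnalyticAt ℂ (fun z : Fin n → ℂ => z i) z₀ :=
  (ContinuousLinearMap.proj (R := ℂ) (φ := fun _ : Fin n => ℂ) i).analyticAt z₀

lemma analyticAt_mon (α : Fin n → ℕ) (z₀ : Fin n → ℂ) : AnalyticAt ℂ (mon α) z₀ := by
  unfold mon
  exact Finset.analyticAt_fun_prod _ fun i _ => (analyticAt_apply i z₀).pow _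

lemma continuous_mon (α : Fin n → ℕ) : Continuous (mon α) := by
  unfold mon
  fun_prop

lemma norm_mon_le (α : Fin n → ℕ) (z : Fin n → ℂ) : ‖mon α z‖ ≤ ‖z‖ ^ ∑ i, α i := by
  unfold mon
  rw [norm_prod, ← Finset.prod_pow_eq_pow_sum]
  refine Finset.prod_le_prod (fun i _ => norm_nonneg _) fun i _ => ?_
  rw [norm_pow]
  exact pow_le_pow_left₀ (norm_nonneg _) (norm_le_pi_norm z i) _

lemma sum_pos_of_ne_zero {α : Fin n → ℕ} (hα : α ≠ 0) : 0 < ∑ i, α i := by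
  obtain ⟨i, hi⟩ := Function.ne_iff.mp hα
  exact Finset.sum_pos' (fun _ _ => Nat.zero_le _) ⟨i, Finset.mem_univ _, Nat.pos_of_ne_zero hi⟩

lemma mon_zero {α : Fin n → ℕ} (hα : α ≠ 0) : mon α 0 = 0 := by
  have := norm_mon_le α 0
  rw [norm_zero, zero_pow (sum_pos_of_ne_zero hα).ne'] at this
  exact norm_le_zero_iff.mp this

lemma isBigO_apply (i : Fin n) :
    (fun z : Fin n → ℂ => z i) =O[𝓝 0] (fun z => ‖z‖) :=
  IsBigO.of_bound 1 (Eventually.of_forall fun z => by simpa using norm_le_pi_norm z i)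

lemma isBigO_norm_pow {d e : ℕ} (h : e ≤ d) :
    (fun z : Fin n → ℂ => ‖z‖ ^ d) =O[𝓝 0] (fun z => ‖z‖ ^ e) := by
  refine IsBigO.of_bound 1 ?_
  filter_upwards [Metric.ball_mem_nhds (0 : Fin n → ℂ) one_pos] with z hz
  rw [mem_ball_zero_iff] at hz
  simp only [norm_pow, norm_norm, one_mul]
  exact pow_le_pow_of_le_one (norm_nonneg _) hz.le h

lemma analyticAt_linear_approx {f : (Fin n → ℂ) → (Fin n → ℂ)} (hf : AnalyticAt ℂ f 0)
    (h0 : f 0 = 0) : (fun z => f z - fderiv ℂ f 0 z) =O[𝓝 0] (fun z => ‖z‖ ^ 2) := by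
  obtain ⟨p, hp⟩ := hf
  have h := hp.isBigO_sub_partialSum_pow 2
  refine h.congr_left fun z => ?_
  rw [zero_add, FormalMultilinearSeries.partialSum, Finset.sum_range_succ, Finset.sum_range_one,
    hp.coeff_zero, h0, zero_add, hp.fderiv_eq]
  congr 1

/-- The lowest order term in the Taylor expansion of a function of order at least `d`. -/
lemma exists_homogeneous_part {f : (Fin n → ℂ) → ℂ} (hf : AnalyticAt ℂ f 0) {d : ℕ}
    (hd : f =O[𝓝 0] (fun z => ‖z‖ ^ d)) :
    ∃ c : (Fin d → Fin n) → ℂ,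
      (fun z => f z - ∑ r, c r * ∏ t, z (r t)) =O[𝓝 0] (fun z => ‖z‖ ^ (d + 1)) := by
  obtain ⟨p, hp⟩ := hf
  -- Lower terms vanish one degree at a time: a homogeneous polynomial of degree e that is
  -- O(|z|^(e+1)) is zero.
  have key : ∀ e ≤ d, ∀ z, p.partialSum e z = 0 := by
    intro e
    induction e with
    | zero => intro _ z; simp [FormalMultilinearSeries.partialSum]
    | succ e ih =>
      intro he z
      have h1 : ∀ z, p.partialSum (e + 1) z = p e fun _ => z := by
        intro z
        have := ih (by omega) z
        rw [FormalMultilinearSeries.partialSum] at this ⊢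
        rw [Finset.sum_range_succ, this, zero_add]
      have h2 := hp.isBigO_sub_partialSum_pow (e + 1)
      have h3 : (fun z => p e fun _ => z) =O[𝓝 0] (fun z => ‖z‖ ^ (e + 1)) := by
        have := (hd.trans (isBigO_norm_pow he)).sub h2
        refine this.congr_left fun z => ?_
        rw [zero_add, h1]; ring
      rw [h1]
      exact h3.continuousMultilinearMap_apply_eq_zero z
  refine ⟨fun r => p d fun t => Pi.single (r t) 1, ?_⟩
  have h := hp.isBigO_sub_partialSum_pow (d + 1)
  refine h.congr_left fun z => ?_
  have h0 := key d le_rfl z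
  rw [FormalMultilinearSeries.partialSum] at h0 ⊢
  rw [Finset.sum_range_succ, h0, zero_add, zero_add]
  congr 1
  have hz : (fun _ : Fin d => z) = fun _ : Fin d => ∑ i, z i • (Pi.single i 1 : Fin n → ℂ) := by
    funext _
    ext i
    simp [Finset.sum_apply, Pi.single_apply]
  rw [hz, ContinuousMultilinearMap.map_sum]
  refine Finset.sum_congr rfl fun r _ => ?_
  rw [ContinuousMultilinearMap.map_smul_univ, smul_eq_mul, mul_comm]

/-- Factors are exchanged one at a time, and each exchange gains e orders. With e = 1 this replaces
the arguments of a monomial of degree d at the cost of an error of order d + 1. -/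
lemma isBigO_prod_sub_prod {ι : Type*} (s : Finset ι) {A B : ι → (Fin n → ℂ) → ℂ} {e : ℕ}
    (hA : ∀ i, A i =O[𝓝 0] (fun z => ‖z‖)) (hB : ∀ i, B i =O[𝓝 0] (fun z => ‖z‖))
    (hAB : ∀ i, (fun z => A i z - B i z) =O[𝓝 0] (fun z => ‖z‖ ^ (e + 1))) :
    (fun z => ∏ i ∈ s, A i z - ∏ i ∈ s, B i z) =O[𝓝 0] (fun z => ‖z‖ ^ (s.card + e)) := by
  classical
  have hP : ∀ s : Finset ι, (fun z => ∏ i ∈ s, A i z) =O[𝓝 0] (fun z => ‖z‖ ^ s.card) := by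
    intro s
    simpa using IsBigO.finsetProd (s := s) (f := A) (g := fun _ z => ‖z‖) (l := 𝓝 0)
      (fun i _ => hA i)
  induction s using Finset.induction_on with
  | empty => simpa using isBigO_zero _ _
  | insert i s hi ih =>
    have h1 := (hAB i).mul (hP s)
    have h2 := (hB i).mul ih
    rw [Finset.card_insert_of_notMem hi]
    refine ((h1.congr_right fun z => ?_).add (h2.congr_right fun z => ?_)).congr_left fun z => ?_
    · ring
    · ring
    · rw [Finset.prod_insert hi, Finset.prod_insert hi]; ring

lemma exists_openPartialHomeomorph {φ : (Fin n → ℂ) → (Fin n → ℂ)} (hφ : IsGermDiffeo φ) :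
    ∃ e : OpenPartialHomeomorph (Fin n → ℂ) (Fin n → ℂ), (0 : Fin n → ℂ) ∈ e.source ∧
      (∀ z, e z = φ z) ∧ AnalyticAt ℂ e.symm 0 := by
  obtain ⟨L, hL⟩ := hφ.invertible
  have h1 : HasStrictFDerivAt φ (L : (Fin n → ℂ) →L[ℂ] (Fin n → ℂ)) 0 := by
    rw [hL]; exact hφ.analytic.hasStrictFDerivAt
  have hs := h1.mem_toOpenPartialHomeomorph_source
  refine ⟨h1.toOpenPartialHomeomorph φ, hs, fun z => rfl, ?_⟩
  have := (h1.toOpenPartialHomeomorph φ).analyticAt_symm' (i := L) hs hφ.analytic hL.symm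
  simpa [hφ.map_zero] using this

lemma Conjugates.trans {φ ψ F G H : (Fin n → ℂ) → (Fin n → ℂ)} (h₁ : Conjugates φ F G)
    (h₂ : Conjugates ψ G H) : Conjugates (φ ∘ ψ) F H := by
  have hψ : Tendsto ψ (𝓝 0) (𝓝 0) := by
    simpa [ContinuousAt, h₂.diffeo.map_zero] using h₂.diffeo.analytic.continuousAt
  have ha : AnalyticAt ℂ φ (ψ 0) := by rw [h₂.diffeo.map_zero]; exact h₁.diffeo.analytic
  refine ⟨⟨ha.comp h₂.diffeo.analytic, by simp [h₁.diffeo.map_zero, h₂.diffeo.map_zero], ?_⟩, ?_⟩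
  · rw [fderiv_comp _ ha.differentiableAt h₂.diffeo.analytic.differentiableAt,
      h₂.diffeo.map_zero]
    exact h₁.diffeo.invertible.comp h₂.diffeo.invertible
  · filter_upwards [hψ.eventually h₁.conj, h₂.conj] with z hz1 hz2
    simp only [Function.comp_apply]
    rw [hz1, hz2]

/-- The factor `λ_j + a_j u^k + u^{k+1} p_j(u)` by which a germ in normal form multiplies the
coordinate `z_j`. -/
noncomputable def resFactor (lam a : Fin n → ℂ) (k : ℕ) (p : Fin n → Polynomial ℂ) (j : Fin n)
    (u : ℂ) : ℂ :=
  lam j + a j * u ^ k + u ^ (k + 1) * (p j).eval u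

lemma analyticAt_resFactor (lam a : Fin n → ℂ) (k : ℕ) (p : Fin n → Polynomial ℂ) (j : Fin n)
    (u₀ : ℂ) : AnalyticAt ℂ (resFactor lam a k p j) u₀ := by
  have hp : AnalyticAt ℂ (fun u => (p j).eval u) u₀ := by
    simpa using AnalyticAt.aeval_polynomial (analyticAt_id (𝕜 := ℂ) (z := u₀)) (p j)
  unfold resFactor
  fun_prop

/-- The first `m` components of `G` are in normal form up to order `d`. -/
def IsNormalUpTo (G : (Fin n → ℂ) → (Fin n → ℂ)) (lam : Fin n → ℂ) (m : ℕ) (α : Fin n → ℕ)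
    (k : ℕ) (a : Fin n → ℂ) (p : Fin n → Polynomial ℂ) (d : ℕ) : Prop :=
  ∀ j : Fin n, (j : ℕ) < m →
    (fun z : Fin n → ℂ => G z j - z j * resFactor lam a k p j (mon α z)) =O[𝓝 0]
      fun z => ‖z‖ ^ d

/-- A degree count: |α|(k+1) + 1 ≥ |α|k + 2 because |α| ≥ 1. Hence the higher resonant terms never
disturb the leading form. -/
lemma isBigO_resFactor_tail {α : Fin n → ℕ} (hα : α ≠ 0) (k : ℕ) (p : Polynomial ℂ)
    (j : Fin n) :
    (fun z : Fin n → ℂ => z j * (mon α z ^ (k + 1) * p.eval (mon α z))) =O[𝓝 0]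
      fun z => ‖z‖ ^ ((∑ i, α i) * k + 2) := by
  have h1 : (fun z : Fin n → ℂ => p.eval (mon α z)) =O[𝓝 0] (fun _ => (1 : ℝ)) := by
    have : ContinuousAt (fun z : Fin n → ℂ => p.eval (mon α z)) 0 :=
      (p.continuous.comp (continuous_mon α)).continuousAt
    exact this.isBigO_one ℝ
  have h2 : (fun z : Fin n → ℂ => mon α z ^ (k + 1)) =O[𝓝 0]
      fun z => ‖z‖ ^ ((∑ i, α i) * (k + 1)) := by
    refine IsBigO.of_bound 1 (Eventually.of_forall fun z => ?_)
    rw [norm_pow, norm_pow, norm_norm, one_mul, pow_mul]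
    exact pow_le_pow_left₀ (norm_nonneg _) (norm_mon_le α z) _
  have h3 := (isBigO_apply j).mul (h2.mul h1)
  have h4 : (∑ i, α i) * k + 2 ≤ (∑ i, α i) * (k + 1) + 1 := by
    have := sum_pos_of_ne_zero hα
    rw [mul_add]; omega
  refine (h3.congr_right fun z => ?_).trans (isBigO_norm_pow h4)
  ring

lemma IsLeadingForm.isNormalUpTo {G : (Fin n → ℂ) → (Fin n → ℂ)} {lam : Fin n → ℂ} {m : ℕ}
    {α : Fin n → ℕ} {k : ℕ} {a : Fin n → ℂ} (hG : IsLeadingForm G lam m α k a) :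
    IsNormalUpTo G lam m α k a 0 ((∑ i, α i) * k + 2) := by
  intro j hj
  refine (hG.expansion j hj).congr_left fun z => ?_
  simp [resFactor]
  ring

lemma IsNormalUpTo.expansion {G : (Fin n → ℂ) → (Fin n → ℂ)} {lam : Fin n → ℂ} {m : ℕ}
    {α : Fin n → ℕ} {k : ℕ} {a : Fin n → ℂ} {p : Fin n → Polynomial ℂ} {d : ℕ} (hα : α ≠ 0)
    (hG : IsNormalUpTo G lam m α k a p d) (hd : (∑ i, α i) * k + 2 ≤ d) (j : Fin n)
    (hj : (j : ℕ) < m) :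
    (fun z : Fin n → ℂ => G z j - (lam j * z j + a j * mon α z ^ k * z j))
      =O[𝓝 0] fun z => ‖z‖ ^ ((∑ i, α i) * k + 2) := by
  refine (((hG j hj).trans (isBigO_norm_pow hd)).add
    (isBigO_resFactor_tail hα k (p j) j)).congr_left fun z => ?_
  simp only [resFactor]
  ring

/-- Splitting a homogeneous polynomial of degree `d` into a resonant part and a solution of the
homological equation. -/
lemma exists_homological_solution {lam : Fin n → ℂ} {m : ℕ} {α : Fin n → ℕ} {k : ℕ}
    (hres : ∀ j : Fin n, (j : ℕ) < m → ∀ l : Fin n → ℕ,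
      IsResonance lam j l → ∃ s : ℕ, 1 ≤ s ∧ l = s • α + Pi.single j 1)
    {d : ℕ} (hd : (∑ i, α i) * k + 2 ≤ d) (j : Fin n) (hj : (j : ℕ) < m)
    (c : (Fin d → Fin n) → ℂ) :
    ∃ (b : (Fin d → Fin n) → ℂ) (q : Polynomial ℂ), ∀ z : Fin n → ℂ,
      ∑ r, c r * ∏ t, z (r t) + lam j * ∑ r, b r * ∏ t, z (r t)
        - ∑ r, b r * ∏ t, (lam (r t) * z (r t)) =
      z j * (mon α z ^ (k + 1) * q.eval (mon α z)) := by
  classical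
  have hs : ∀ r : Fin d → Fin n, ∃ s : ℕ, lam j = ∏ t, lam (r t) →
      ∀ z : Fin n → ℂ, ∏ t, z (r t) = z j * (mon α z ^ (k + 1) * mon α z ^ s) := by
    intro r
    by_cases h : lam j = ∏ t, lam (r t)
    · set l : Fin n → ℕ := fun i => (Finset.univ.filter fun t => r t = i).card with hl
      have hsum : ∑ i, l i = d := by
        rw [← Finset.card_eq_sum_card_fiberwise (fun t _ => Finset.mem_univ (r t))]
        simp
      obtain ⟨s, -, hs⟩ := hres j hj l ⟨by omega, by rw [h, mon_eq_prod_comp]⟩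
      have hsd : s * (∑ i, α i) + 1 = d := by
        rw [← hsum, hs]
        simp [Finset.sum_add_distrib, Finset.mul_sum, Pi.single_apply]
      -- The degree s|α| + 1 = d ≥ |α|k + 2 forces s > k, so a resonant term found at this stage
      -- goes into the tail and leaves the coefficients a_j alone.
      have hks : k < s := by
        by_contra hc
        have := Nat.mul_le_mul_right (∑ i, α i) (not_lt.mp hc)
        rw [mul_comm] at hd
        omega
      refine ⟨s - (k + 1), fun _ z => ?_⟩
      rw [mon_eq_prod_comp, ← hl, hs, mon_add_single, ← pow_add,
        Nat.add_sub_cancel' (by omega), mul_comm]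
    · exact ⟨0, fun h' => absurd h' h⟩
  choose s hs using hs
  -- A nonresonant word is removed by dividing by λ^r - λ_j, which is nonzero exactly then; resonant
  -- words are collected in q.
  refine ⟨fun r => if lam j = ∏ t, lam (r t) then 0 else c r / (∏ t, lam (r t) - lam j),
    ∑ r, if lam j = ∏ t, lam (r t) then Polynomial.C (c r) * Polynomial.X ^ s r else 0,
    fun z => ?_⟩
  rw [Polynomial.eval_finsetSum, Finset.mul_sum, Finset.mul_sum, Finset.mul_sum,
    ← Finset.sum_add_distrib, ← Finset.sum_sub_distrib]
  refine Finset.sum_congr rfl fun r _ => ?_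
  rw [Finset.prod_mul_distrib]
  by_cases h : lam j = ∏ t, lam (r t)
  · rw [hs r h z]
    simp only [if_pos h, Polynomial.eval_mul, Polynomial.eval_C, Polynomial.eval_pow,
      Polynomial.eval_X]
    ring
  · have : (∏ t, lam (r t)) - lam j ≠ 0 := sub_ne_zero.mpr (Ne.symm h)
    simp only [if_neg h, Polynomial.eval_zero, mul_zero]
    field_simp
    ring

lemma IsGermDiffeo.tendsto {φ : (Fin n → ℂ) → (Fin n → ℂ)} (hφ : IsGermDiffeo φ) :
    Tendsto φ (𝓝 0) (𝓝 0) := by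
  simpa [ContinuousAt, hφ.map_zero] using hφ.analytic.continuousAt

/-- A coordinate change tangent to the identity. -/
lemma exists_conjugates_of_isBigO {G P : (Fin n → ℂ) → (Fin n → ℂ)} (hG : IsGermDiffeo G)
    (hP : AnalyticAt ℂ P 0) (hPO : P =O[𝓝 0] fun z => ‖z‖ ^ 2) :
    ∃ G' : (Fin n → ℂ) → (Fin n → ℂ), Conjugates (fun z => z + P z) G G' ∧ IsGermDiffeo G' ∧
      fderiv ℂ G' 0 = fderiv ℂ G 0 := by
  have hP0 : P 0 = 0 := by
    have := hPO.eq_zero_imp.self_of_nhds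
    simpa using this
  have hPd : HasFDerivAt P (0 : (Fin n → ℂ) →L[ℂ] (Fin n → ℂ)) 0 := by
    refine HasFDerivAt.of_isLittleO ?_
    have h1 : (fun z : Fin n → ℂ => ‖z‖ ^ 2) =o[𝓝 0] (fun z => ‖z‖ ^ 1) :=
      (isLittleO_norm_pow_norm_pow (by norm_num))
    simp only [pow_one] at h1
    simpa only [hP0, sub_zero, zero_apply] using
      (hPO.trans_isLittleO h1).of_norm_right
  have hφ' : HasFDerivAt (fun z => z + P z) (ContinuousLinearMap.id ℂ (Fin n → ℂ)) 0 := by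
    simpa using (hasFDerivAt_id (0 : Fin n → ℂ)).add hPd
  have hφ : IsGermDiffeo (fun z => z + P z) := by
    refine ⟨analyticAt_id.add hP, by simp [hP0], ?_⟩
    rw [hφ'.fderiv]
    exact ⟨ContinuousLinearEquiv.refl ℂ _, rfl⟩
  obtain ⟨e, he, heφ, hes⟩ := exists_openPartialHomeomorph hφ
  have he0 : e 0 = 0 := by rw [heφ]; simp [hP0]
  have hes0 : e.symm 0 = 0 := by
    conv_lhs => rw [← he0]
    exact e.left_inv he
  have hesd : HasFDerivAt e.symm (ContinuousLinearMap.id ℂ (Fin n → ℂ)) 0 := by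
    have hh : HasFDerivAt e
        ((ContinuousLinearEquiv.refl ℂ (Fin n → ℂ) :
          (Fin n → ℂ) →L[ℂ] (Fin n → ℂ))) (e.symm 0) := by
      rw [hes0]
      exact hφ'.congr_of_eventuallyEq (Eventually.of_forall heφ)
    exact e.hasFDerivAt_symm (by rw [← he0]; exact e.map_source he) hh
  have hGφ : AnalyticAt ℂ (fun z => G (z + P z)) 0 := by
    refine AnalyticAt.comp (g := G) ?_ hφ.analytic
    simpa [hP0] using hG.analytic
  have hGφ0 : G (0 + P 0) = 0 := by simp [hP0, hG.map_zero]
  have hGφd : HasFDerivAt (fun z => G (z + P z)) (fderiv ℂ G 0) 0 := by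
    have h1 : HasFDerivAt G (fderiv ℂ G 0) (0 + P 0) := by
      simpa [hP0] using hG.analytic.differentiableAt.hasFDerivAt
    simpa using h1.comp (0 : Fin n → ℂ) hφ'
  have hd : HasFDerivAt (fun z => e.symm (G (z + P z))) (fderiv ℂ G 0) 0 := by
    have h1 : HasFDerivAt e.symm (ContinuousLinearMap.id ℂ (Fin n → ℂ)) (G (0 + P 0)) := by
      rw [hGφ0]; exact hesd
    simpa using h1.comp (0 : Fin n → ℂ) hGφd
  refine ⟨fun z => e.symm (G (z + P z)), ⟨hφ, ?_⟩, ⟨?_, ?_, ?_⟩, hd.fderiv⟩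
  · have h1 : Tendsto (fun z => G (z + P z)) (𝓝 0) (𝓝 0) := by
      have := hGφ.continuousAt.tendsto
      rwa [hGφ0] at this
    filter_upwards [h1.eventually (e.open_target.mem_nhds (he0 ▸ e.map_source he))] with z hz
    have := e.right_inv hz
    rw [heφ] at this
    exact this.symm
  · refine AnalyticAt.comp (g := e.symm) ?_ hGφ
    rw [hGφ0]; exact hes
  · simp only [hGφ0, hes0]
  · rw [hd.fderiv]; exact hG.invertible

/-- One step of the reduction to normal form. -/
lemma exists_normal_succ {G : (Fin n → ℂ) → (Fin n → ℂ)} {lam : Fin n → ℂ} {m : ℕ}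
    {α : Fin n → ℕ} {k : ℕ} {a : Fin n → ℂ} {p : Fin n → Polynomial ℂ} {d : ℕ} (hα : α ≠ 0)
    (hres : ∀ j : Fin n, (j : ℕ) < m → ∀ l : Fin n → ℕ,
      IsResonance lam j l → ∃ s : ℕ, 1 ≤ s ∧ l = s • α + Pi.single j 1)
    (hG : IsLeadingForm G lam m α k a) (hd : (∑ i, α i) * k + 2 ≤ d)
    (hN : IsNormalUpTo G lam m α k a p d) :
    ∃ (φ G' : (Fin n → ℂ) → (Fin n → ℂ)) (p' : Fin n → Polynomial ℂ), Conjugates φ G G' ∧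
      IsLeadingForm G' lam m α k a ∧ IsNormalUpTo G' lam m α k a p' (d + 1) := by
  classical
  have hfa : ∀ j, AnalyticAt ℂ (fun z => G z j - z j * resFactor lam a k p j (mon α z)) 0 := by
    intro j
    have h1 : AnalyticAt ℂ (fun z => G z j) 0 :=
      AnalyticAt.comp (g := fun w : Fin n → ℂ => w j) (analyticAt_apply j _) hG.diffeo.analytic
    have h2 : AnalyticAt ℂ (fun z => resFactor lam a k p j (mon α z)) 0 :=
      AnalyticAt.comp (analyticAt_resFactor ..) (analyticAt_mon α 0)
    exact h1.sub ((analyticAt_apply j 0).mul h2)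
  have hsol : ∀ j : Fin n, ∃ (c b : (Fin d → Fin n) → ℂ) (q : Polynomial ℂ), (j : ℕ) < m →
      ((fun z => G z j - z j * resFactor lam a k p j (mon α z) - ∑ r, c r * ∏ t, z (r t))
        =O[𝓝 0] fun z => ‖z‖ ^ (d + 1)) ∧
      ∀ z : Fin n → ℂ, ∑ r, c r * ∏ t, z (r t) + lam j * ∑ r, b r * ∏ t, z (r t)
        - ∑ r, b r * ∏ t, (lam (r t) * z (r t)) =
      z j * (mon α z ^ (k + 1) * q.eval (mon α z)) := by
    intro j
    by_cases hj : (j : ℕ) < m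
    · obtain ⟨c, hc⟩ := exists_homogeneous_part (hfa j) (hN j hj)
      obtain ⟨b, q, hbq⟩ := exists_homological_solution hres hd j hj c
      exact ⟨c, b, q, fun _ => ⟨hc, hbq⟩⟩
    · exact ⟨0, 0, 0, fun h => absurd h hj⟩
  choose c b q hcbq using hsol
  -- The coordinate change is id + P; components from m on are left alone, as nothing is known about
  -- their resonances.
  set P : (Fin n → ℂ) → (Fin n → ℂ) :=
    fun z j => if (j : ℕ) < m then ∑ r, b j r * ∏ t, z (r t) else 0 with hPdef
  have hPa : AnalyticAt ℂ P 0 := by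
    refine AnalyticAt.pi fun j => ?_
    by_cases hj : (j : ℕ) < m
    · simp only [hj, if_true]
      exact Finset.analyticAt_fun_sum _ fun r _ => analyticAt_const.mul
        (Finset.analyticAt_fun_prod _ fun t _ => analyticAt_apply _ _)
    · simp only [hj, if_false]
      exact analyticAt_const
  have hPd : P =O[𝓝 0] fun z => ‖z‖ ^ d := by
    refine isBigO_pi.mpr fun j => ?_
    by_cases hj : (j : ℕ) < m
    · simp only [hPdef, hj, if_true]
      refine IsBigO.fun_sum fun r _ => IsBigO.const_mul_left ?_ _
      simpa using IsBigO.finsetProd (s := (Finset.univ : Finset (Fin d)))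
        (f := fun t (z : Fin n → ℂ) => z (r t)) (g := fun _ z => ‖z‖) (l := 𝓝 0)
        (fun t _ => isBigO_apply (r t))
    · simp only [hPdef, hj, if_false]
      exact isBigO_zero _ _
  obtain ⟨G', hconj, hG', hfd⟩ := exists_conjugates_of_isBigO hG.diffeo hPa
    (hPd.trans (isBigO_norm_pow (by omega)))
  have hlin : ∀ i, (fun z => G' z i - lam i * z i) =O[𝓝 0] fun z => ‖z‖ ^ (1 + 1) := by
    intro i
    have := isBigO_pi.mp (analyticAt_linear_approx hG'.analytic hG'.map_zero) i
    refine this.congr_left fun z => ?_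
    rw [Pi.sub_apply, hfd, hG.diagonal]
  have hlin1 : ∀ i, (fun z : Fin n → ℂ => lam i * z i) =O[𝓝 0] fun z => ‖z‖ :=
    fun i => (isBigO_apply i).const_mul_left _
  have hG'1 : ∀ i, (fun z => G' z i) =O[𝓝 0] fun z => ‖z‖ := by
    intro i
    have h1 := (hlin i).trans (isBigO_norm_pow (e := 1) (by omega))
    simp only [pow_one] at h1
    simpa using h1.add (hlin1 i)
  have hφO : (fun z : Fin n → ℂ => z + P z) =O[𝓝 0] fun z => ‖z‖ := by
    have h1 := hPd.trans (isBigO_norm_pow (e := 1) (by omega))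
    simp only [pow_one] at h1
    exact (isBigO_refl (fun z : Fin n → ℂ => z) (𝓝 0)).norm_right.add h1
  have hφt : Tendsto (fun z : Fin n → ℂ => z + P z) (𝓝 0) (𝓝 0) := hconj.diffeo.tendsto
  have hnorm : IsNormalUpTo G' lam m α k a (fun j => p j + q j) (d + 1) := by
    intro j hj
    obtain ⟨hc, hbq⟩ := hcbq j hj
    -- the expansion of `G_j` at `z + P z`
    have e1 : (fun z => G (z + P z) j - (z + P z) j * resFactor lam a k p j (mon α (z + P z))
        - ∑ r, c j r * ∏ t, (z + P z) (r t)) =O[𝓝 0] fun z => ‖z‖ ^ (d + 1) :=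
      (hc.comp_tendsto hφt).trans ((hφO.norm_left).pow (d + 1))
    -- replacing `z + P z` by `z` in the resonant and the homogeneous part
    have e2 : (fun z => ∑ r, c j r * ∏ t, (z + P z) (r t) - ∑ r, c j r * ∏ t, z (r t))
        =O[𝓝 0] fun z => ‖z‖ ^ (d + 1) := by
      have : ∀ r : Fin d → Fin n, (fun z => ∏ t, (z + P z) (r t) - ∏ t, z (r t)) =O[𝓝 0]
          fun z => ‖z‖ ^ (d + 1) := by
        intro r
        have := isBigO_prod_sub_prod (n := n) (Finset.univ : Finset (Fin d)) (e := 1)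
          (A := fun t z => (z + P z) (r t)) (B := fun t z => z (r t))
          (fun t => isBigO_pi.mp hφO (r t)) (fun t => isBigO_apply (r t)) (fun t => by
            refine ((isBigO_pi.mp hPd (r t)).trans (isBigO_norm_pow (by omega))).congr_left
              fun z => ?_
            simp)
        simpa using this
      refine (IsBigO.fun_sum (s := Finset.univ) fun r _ =>
        (this r).const_mul_left (c j r)).congr_left fun z => ?_
      simp only [mul_sub, Finset.sum_sub_distrib]
    -- Up to order d, only the linear term λ_j z_j of the resonant part feels the substitution: the
    -- factor `Q` has value λ_j at 0 and changes by O(|z|^d), which is multiplied by z_j.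
    have e3 : (fun z => (z + P z) j * resFactor lam a k p j (mon α (z + P z))
        - (z j * resFactor lam a k p j (mon α z) + lam j * P z j))
        =O[𝓝 0] fun z => ‖z‖ ^ (d + 1) := by
      set Q : (Fin n → ℂ) → ℂ := fun z => resFactor lam a k p j (mon α z) with hQ
      have hQa : AnalyticAt ℂ Q 0 :=
        AnalyticAt.comp (analyticAt_resFactor ..) (analyticAt_mon α 0)
      have hQ0 : Q 0 = lam j := by
        have hk := hG.one_le
        simp [hQ, mon_zero hα, resFactor, show k ≠ 0 by omega]
      have h1 : (fun z => Q (z + P z) - Q z) =O[𝓝 0] fun z => ‖z‖ ^ d := by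
        have ht : Tendsto (fun z : Fin n → ℂ => (z + P z, z)) (𝓝 0) (𝓝 (0, 0)) :=
          hφt.prodMk_nhds tendsto_id
        have := hQa.hasStrictFDerivAt.isBigO_sub.comp_tendsto ht
        refine this.trans (hPd.congr_left fun z => ?_)
        simp
      have h2 : (fun z => Q (z + P z) - lam j) =O[𝓝 0] fun z => ‖z‖ := by
        have := hQa.differentiableAt.isBigO_sub
        rw [hQ0] at this
        have := this.comp_tendsto hφt
        refine this.trans (hφO.congr_left fun z => ?_)
        simp
      have h3 := (isBigO_apply j).mul h1
      have h4 := (isBigO_pi.mp hPd j).mul h2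
      refine ((h3.congr_right fun z => ?_).add (h4.congr_right fun z => ?_)).congr_left
        fun z => ?_
      · ring
      · ring
      · simp only [Pi.add_apply]
        ring
    have e4 : (fun z => P (G' z) j - ∑ r, b j r * ∏ t, (lam (r t) * z (r t)))
        =O[𝓝 0] fun z => ‖z‖ ^ (d + 1) := by
      have : ∀ r : Fin d → Fin n, (fun z => ∏ t, G' z (r t) - ∏ t, (lam (r t) * z (r t)))
          =O[𝓝 0] fun z => ‖z‖ ^ (d + 1) := by
        intro r
        have := isBigO_prod_sub_prod (n := n) (Finset.univ : Finset (Fin d)) (e := 1)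
          (A := fun t z => G' z (r t)) (B := fun t z => lam (r t) * z (r t))
          (fun t => hG'1 (r t)) (fun t => hlin1 (r t)) (fun t => hlin (r t))
        simpa using this
      refine (IsBigO.fun_sum (s := Finset.univ) fun r _ =>
        (this r).const_mul_left (b j r)).congr_left fun z => ?_
      simp only [hPdef, hj, if_true, mul_sub, Finset.sum_sub_distrib]
    -- By conjugacy G(z + P z) = G'(z) + P(G' z). In e1 + e2 + e3 - e4 everything of degree d then
    -- combines into the homological expression, which `hbq` evaluates as the new resonant term z_j
    -- u^(k+1) q(u).
    refine ((((e1.add e2).add e3).sub e4)).congr' ?_ EventuallyEq.rfl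
    filter_upwards [hconj.conj] with z hz
    have hz' := congrFun hz j
    simp only [Pi.add_apply] at hz'
    have hPz : P z j = ∑ r, b j r * ∏ t, z (r t) := by simp only [hPdef, hj, if_true]
    have := hbq z
    rw [hz', hPz]
    simp only [resFactor, Polynomial.eval_add] at this ⊢
    linear_combination -this
  refine ⟨_, G', fun j => p j + q j, hconj, ⟨hG', ?_, hG.one_le, hG.coeff_ne_zero, ?_⟩, hnorm⟩
  · intro z i
    rw [hfd, hG.diagonal]
  · exact hnorm.expansion hα (by omega)

/-- Reduction to normal form up to any order. -/
lemma exists_normal {F : (Fin n → ℂ) → (Fin n → ℂ)} {lam : Fin n → ℂ} {m : ℕ}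
    {α : Fin n → ℕ} {k : ℕ} {a : Fin n → ℂ} (hα : α ≠ 0)
    (hres : ∀ j : Fin n, (j : ℕ) < m → ∀ l : Fin n → ℕ,
      IsResonance lam j l → ∃ s : ℕ, 1 ≤ s ∧ l = s • α + Pi.single j 1)
    (hF : HasOrder F lam m α k a) (N : ℕ) :
    ∃ (φ G : (Fin n → ℂ) → (Fin n → ℂ)) (p : Fin n → Polynomial ℂ), Conjugates φ F G ∧
      IsLeadingForm G lam m α k a ∧ IsNormalUpTo G lam m α k a p N := by
  suffices h : ∀ e, ∃ (φ G : (Fin n → ℂ) → (Fin n → ℂ)) (p : Fin n → Polynomial ℂ),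
      Conjugates φ F G ∧ IsLeadingForm G lam m α k a ∧
      IsNormalUpTo G lam m α k a p ((∑ i, α i) * k + 2 + e) by
    obtain ⟨φ, G, p, h1, h2, h3⟩ := h N
    exact ⟨φ, G, p, h1, h2, fun j hj => (h3 j hj).trans (isBigO_norm_pow (by omega))⟩
  intro e
  induction e with
  | zero =>
    obtain ⟨φ, G, h1, h2⟩ := hF
    exact ⟨φ, G, 0, h1, h2, h2.isNormalUpTo⟩
  | succ e ih =>
    obtain ⟨φ, G, p, h1, h2, h3⟩ := ih
    obtain ⟨ψ, G', p', h4, h5, h6⟩ := exists_normal_succ hα hres h2 (by omega) h3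
    exact ⟨_, G', p', h1.trans h4, h5, h6⟩

end

/-! ### The Fatou coordinate and the geometry of sectors -/

/-- The approximate Fatou coordinate `-1 / (A u^k)`. -/
noncomputable def fatou (A : ℂ) (k : ℕ) (u : ℂ) : ℂ := -(A * u ^ k)⁻¹

/-- The part of the sector `|Im w| < τ Re w` to the right of `Re w = R`. -/
def cone (R τ : ℝ) : Set ℂ := {w | R < w.re ∧ |w.im| < τ * w.re}

/-- Inversion sends a disc with 0 on its boundary to a half-plane: both sides say |w|² + 2δ Re w <
0. At w = 0 both fail, the inverse of 0 being 0. -/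
lemma norm_add_ofReal_lt_iff {w : ℂ} {δ : ℝ} (hδ : 0 < δ) :
    ‖w + (δ : ℂ)‖ < δ ↔ (2 * δ)⁻¹ < (-w⁻¹).re := by
  rcases eq_or_ne w 0 with rfl | hw
  · simp [abs_of_pos hδ, hδ.le]
  have hn : 0 < Complex.normSq w := Complex.normSq_pos.mpr hw
  have h1 : ‖w + (δ : ℂ)‖ < δ ↔ Complex.normSq w + 2 * δ * w.re < 0 := by
    rw [← sq_lt_sq₀ (norm_nonneg _) hδ.le, ← Complex.normSq_eq_norm_sq, Complex.normSq_apply,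
      Complex.normSq_apply]
    simp only [Complex.add_re, Complex.ofReal_re, Complex.add_im, Complex.ofReal_im, add_zero]
    constructor <;> intro h <;> nlinarith
  rw [h1, Complex.neg_re, Complex.inv_re, ← neg_div, lt_div_iff₀ hn,
    inv_mul_lt_iff₀ (by positivity)]
  constructor <;> intro h <;> linarith

lemma abs_im_lt_iff_abs_arg_lt {w : ℂ} (hw : 0 < w.re) {τ : ℝ} :
    |w.im| < τ * w.re ↔ |w.arg| < Real.arctan τ := by
  have h1 : |w.arg| < Real.pi / 2 := Complex.abs_arg_lt_pi_div_two_iff.mpr (Or.inl hw)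
  rw [abs_lt] at h1
  have h2 : w.arg = Real.arctan (w.im / w.re) := by
    rw [← Complex.tan_arg, Real.arctan_tan h1.1 h1.2]
  rw [h2, abs_lt, abs_lt, ← Real.arctan_neg, Real.arctan_strictMono.lt_iff_lt,
    Real.arctan_strictMono.lt_iff_lt, lt_div_iff₀ hw, div_lt_iff₀ hw, neg_mul]

lemma arg_pow_of_abs_arg_lt {t : ℂ} {k : ℕ} (hk : 1 ≤ k) (ht : |t.arg| < Real.pi / k) :
    (t ^ k).arg = k * t.arg := by
  have hk' : (0 : ℝ) < k := by exact_mod_cast hk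
  have h := Complex.arg_pow_coe_angle t k
  rw [← Real.Angle.natCast_mul_eq_nsmul] at h
  rw [abs_lt, lt_div_iff₀ hk', ← neg_div, div_lt_iff₀ hk'] at ht
  have h2 := congrArg Real.Angle.toReal h
  rwa [Complex.arg_coe_angle_toReal_eq_arg, Real.Angle.toReal_coe_eq_self_iff.mpr] at h2
  constructor <;> nlinarith

lemma arg_cpow_nat_inv (x : ℂ) {k : ℕ} (hk : 1 ≤ k) :
    (x ^ ((k : ℂ)⁻¹)).arg = x.arg / k := by
  have hk' : (1 : ℝ) ≤ k := by exact_mod_cast hk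
  rcases eq_or_ne x 0 with rfl | hx
  · rw [Complex.zero_cpow (by simp; omega)]; simp
  rw [Complex.cpow_def_of_ne_zero hx]
  have him : (Complex.log x * (k : ℂ)⁻¹).im = x.arg / k := by
    rw [← Complex.ofReal_natCast, ← Complex.ofReal_inv, Complex.im_mul_ofReal, Complex.log_im]
    rfl
  have h1 := Complex.neg_pi_lt_arg x
  have h2 := Complex.arg_le_pi x
  have hpi := Real.pi_pos
  rw [← Complex.log_im, Complex.log_exp, him]
  · rw [him, lt_div_iff₀ (by linarith)]; nlinarith
  · rw [him, div_le_iff₀ (by linarith)]; nlinarith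

section

variable {A : ℂ} {k : ℕ} {v : ℂ}

lemma direction_ne_zero (hA : A ≠ 0) (hk : 1 ≤ k) (hv : v ^ k = -((‖A‖ : ℂ) / A)) : v ≠ 0 := by
  rintro rfl
  rw [zero_pow (by omega)] at hv
  have : (‖A‖ : ℂ) / A ≠ 0 := div_ne_zero (by simpa using hA) hA
  exact this (by rw [eq_comm, neg_eq_zero] at hv; exact hv)

lemma norm_direction (hA : A ≠ 0) (hk : 1 ≤ k) (hv : v ^ k = -((‖A‖ : ℂ) / A)) : ‖v‖ = 1 := by
  have h := congrArg norm hv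
  rw [norm_pow, norm_neg, norm_div, Complex.norm_real, norm_norm,
    div_self (norm_ne_zero_iff.mpr hA)] at h
  exact (pow_eq_one_iff_of_nonneg (norm_nonneg _) (by omega)).mp h

/-- The normalization of v gives A u^k = -|A| (u/v)^k, so the ray through v corresponds to the
positive real axis. -/
lemma fatou_eq (hA : A ≠ 0) (hk : 1 ≤ k) (hv : v ^ k = -((‖A‖ : ℂ) / A)) (u : ℂ) :
    fatou A k u = ((‖A‖ : ℂ) * (u / v) ^ k)⁻¹ := by
  have hv0 := direction_ne_zero hA hk hv
  have hA' : (‖A‖ : ℂ) ≠ 0 := by simpa using hA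
  rw [fatou, div_pow, hv, ← inv_neg]
  congr 1
  field_simp

lemma norm_fatou (A : ℂ) (k : ℕ) (u : ℂ) : ‖fatou A k u‖ = (‖A‖ * ‖u‖ ^ k)⁻¹ := by
  simp [fatou]

lemma mul_pow_eq_neg_inv_fatou (A : ℂ) (k : ℕ) (u : ℂ) : A * u ^ k = -(fatou A k u)⁻¹ := by
  simp [fatou, inv_neg]

lemma abs_arg_fatou (hA : A ≠ 0) (hk : 1 ≤ k) (hv : v ^ k = -((‖A‖ : ℂ) / A)) {u : ℂ}
    (hu : |(u / v).arg| < Real.pi / k) : |(fatou A k u).arg| = k * |(u / v).arg| := by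
  rw [fatou_eq hA hk hv, Complex.abs_arg_inv, Complex.arg_real_mul _ (norm_pos_iff.mpr hA),
    arg_pow_of_abs_arg_lt hk hu, abs_mul, Nat.abs_cast]

/-- The sector is one branch of the preimage of a cone. The preimage has k branches, and |Arg(u/v)|
< π/k selects the one at v; the aperture arctan τ becomes arctan τ / k under the k-th root. -/
lemma mem_petalSector_iff (hA : A ≠ 0) (hk : 1 ≤ k) (hv : v ^ k = -((‖A‖ : ℂ) / A)) {τ δ : ℝ}
    (hδ : 0 < δ) {u : ℂ} :
    u ∈ petalSector A k δ (Real.arctan τ / k) v ↔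
      fatou A k u ∈ cone (2 * δ)⁻¹ τ ∧ |(u / v).arg| < Real.pi / k := by
  have hk' : (0 : ℝ) < k := by exact_mod_cast hk
  have hδ' : (0 : ℝ) < (2 * δ)⁻¹ := by positivity
  have hpi : Real.arctan τ / k < Real.pi / k := by
    have := Real.arctan_lt_pi_div_two τ
    have := Real.pi_pos
    gcongr
    linarith
  simp only [petalSector, cone, Set.mem_ofPred_eq]
  rw [norm_add_ofReal_lt_iff hδ, ← fatou]
  constructor
  · rintro ⟨h1, h2⟩
    have h3 := h2.trans hpi
    refine ⟨⟨h1, ?_⟩, h3⟩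
    rw [abs_im_lt_iff_abs_arg_lt (hδ'.trans h1), abs_arg_fatou hA hk hv h3, mul_comm]
    rwa [lt_div_iff₀ hk'] at h2
  · rintro ⟨⟨h1, h2⟩, h3⟩
    refine ⟨h1, ?_⟩
    rw [abs_im_lt_iff_abs_arg_lt (hδ'.trans h1), abs_arg_fatou hA hk hv h3, mul_comm] at h2
    rwa [lt_div_iff₀ hk']

lemma eq_of_mem_petalSector (hA : A ≠ 0) (hk : 1 ≤ k) (hv : v ^ k = -((‖A‖ : ℂ) / A)) {u : ℂ}
    (hu : |(u / v).arg| < Real.pi / k) :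
    u = v * ((‖A‖ : ℂ) * fatou A k u)⁻¹ ^ ((k : ℂ)⁻¹) := by
  have hv0 := direction_ne_zero hA hk hv
  have hA' : (‖A‖ : ℂ) ≠ 0 := by simpa using hA
  have h1 : ((‖A‖ : ℂ) * fatou A k u)⁻¹ = (u / v) ^ k := by
    rw [fatou_eq hA hk hv, mul_inv, inv_inv, inv_mul_cancel_left₀ hA']
  rw [abs_lt] at hu
  rw [h1, Complex.pow_cpow_nat_inv (by omega) hu.1 hu.2.le, mul_div_cancel₀ _ hv0]

lemma fatou_cpow (hA : A ≠ 0) (hk : 1 ≤ k) (hv : v ^ k = -((‖A‖ : ℂ) / A)) (w : ℂ) :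
    fatou A k (v * ((‖A‖ : ℂ) * w)⁻¹ ^ ((k : ℂ)⁻¹)) = w := by
  have hv0 := direction_ne_zero hA hk hv
  have hA' : (‖A‖ : ℂ) ≠ 0 := by simpa using hA
  rw [fatou_eq hA hk hv, mul_div_cancel_left₀ _ hv0, Complex.cpow_nat_inv_pow _ (by omega),
    mul_inv, inv_inv, inv_mul_cancel_left₀ hA']

lemma cpow_mem_petalSector (hA : A ≠ 0) (hk : 1 ≤ k) (hv : v ^ k = -((‖A‖ : ℂ) / A))
    {τ δ : ℝ} (hδ : 0 < δ) {w : ℂ} (hw : w ∈ cone (2 * δ)⁻¹ τ) :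
    v * ((‖A‖ : ℂ) * w)⁻¹ ^ ((k : ℂ)⁻¹) ∈ petalSector A k δ (Real.arctan τ / k) v := by
  have hv0 := direction_ne_zero hA hk hv
  have hk' : (0 : ℝ) < k := by exact_mod_cast hk
  have hδ' : (0 : ℝ) < (2 * δ)⁻¹ := by positivity
  rw [mem_petalSector_iff hA hk hv hδ, fatou_cpow hA hk hv]
  refine ⟨hw, ?_⟩
  rw [mul_div_cancel_left₀ _ hv0, arg_cpow_nat_inv _ hk, abs_div, Complex.abs_arg_inv,
    Complex.arg_real_mul _ (norm_pos_iff.mpr hA), abs_of_pos hk']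
  have h1 : |w.arg| < Real.pi / 2 :=
    Complex.abs_arg_lt_pi_div_two_iff.mpr (Or.inl (hδ'.trans hw.1))
  have := Real.pi_pos
  gcongr
  linarith

lemma convex_cone (R τ : ℝ) : Convex ℝ (cone R τ) := by
  intro x hx y hy a b ha hb hab
  simp only [cone, Set.mem_ofPred_eq, abs_lt, Complex.add_re, Complex.add_im, Complex.real_smul,
    Complex.re_ofReal_mul, Complex.im_ofReal_mul] at hx hy ⊢
  obtain ⟨hx1, hx2, hx3⟩ := hx
  obtain ⟨hy1, hy2, hy3⟩ := hy
  rcases ha.eq_or_lt with rfl | ha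
  · have : b = 1 := by linarith
    subst this
    simp [hy1, hy3, hy2]
  · have hb' : b = 1 - a := by linarith
    refine ⟨?_, ?_, ?_⟩
    · have : R = a * R + b * R := by rw [hb']; ring
      nlinarith [mul_lt_mul_of_pos_left hx1 ha, mul_le_mul_of_nonneg_left hy1.le hb]
    · nlinarith [mul_lt_mul_of_pos_left hx2 ha, mul_le_mul_of_nonneg_left hy2.le hb]
    · nlinarith [mul_lt_mul_of_pos_left hx3 ha, mul_le_mul_of_nonneg_left hy3.le hb]

lemma ne_zero_of_mem_petalSector {δ ε : ℝ} (hk : 1 ≤ k) {u : ℂ}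
    (hu : u ∈ petalSector A k δ ε v) : u ≠ 0 := by
  rintro rfl
  have := hu.1
  rw [zero_pow (by omega), mul_zero, zero_add, Complex.norm_real, Real.norm_eq_abs] at this
  exact absurd this (not_lt.mpr (le_abs_self δ))

lemma continuousAt_fatou (hA : A ≠ 0) {u : ℂ} (hu : u ≠ 0) : ContinuousAt (fatou A k) u := by
  unfold fatou
  refine ContinuousAt.neg (ContinuousAt.inv₀ (by fun_prop) ?_)
  exact mul_ne_zero hA (pow_ne_zero _ hu)

/-- The Fatou coordinate, with the principal k-th root as inverse, is a homeomorphism onto a convex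
cone, which is contractible. -/
lemma simplyConnectedSpace_petalSector (hA : A ≠ 0) (hk : 1 ≤ k)
    (hv : v ^ k = -((‖A‖ : ℂ) / A)) {τ δ : ℝ} (hτ : 0 < τ) (hδ : 0 < δ) :
    SimplyConnectedSpace (petalSector A k δ (Real.arctan τ / k) v) := by
  have hδ' : (0 : ℝ) < (2 * δ)⁻¹ := by positivity
  have hne : (cone (2 * δ)⁻¹ τ).Nonempty := by
    refine ⟨(((2 * δ)⁻¹ + 1 : ℝ) : ℂ), ?_, ?_⟩
    · rw [Complex.ofReal_re]; linarith
    · rw [Complex.ofReal_re, Complex.ofReal_im, abs_zero]; positivity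
  have hc : ContractibleSpace (cone (2 * δ)⁻¹ τ) := (convex_cone _ _).contractibleSpace hne
  let e : petalSector A k δ (Real.arctan τ / k) v ≃ₜ cone (2 * δ)⁻¹ τ :=
    { toFun := fun u => ⟨fatou A k u, ((mem_petalSector_iff hA hk hv hδ).mp u.2).1⟩
      invFun := fun w => ⟨_, cpow_mem_petalSector hA hk hv hδ w.2⟩
      left_inv := fun u => Subtype.ext
        (eq_of_mem_petalSector hA hk hv ((mem_petalSector_iff hA hk hv hδ).mp u.2).2).symm
      right_inv := fun w => Subtype.ext (fatou_cpow hA hk hv w)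
      continuous_toFun := by
        refine Continuous.subtype_mk (continuous_iff_continuousAt.mpr fun u => ?_) _
        exact ContinuousAt.comp (g := fatou A k)
          (continuousAt_fatou hA (ne_zero_of_mem_petalSector hk u.2))
          continuous_subtype_val.continuousAt
      continuous_invFun := by
        refine Continuous.subtype_mk (continuous_iff_continuousAt.mpr fun w => ?_) _
        have hw : 0 < (w : ℂ).re := hδ'.trans w.2.1
        have hA0 := norm_pos_iff.mpr hA
        have hAw : 0 < ((‖A‖ : ℂ) * w).re := by
          rw [Complex.re_ofReal_mul]; positivity
        have hne : ((‖A‖ : ℂ) * w) ≠ 0 := fun h => by simp [h] at hAw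
        refine continuousAt_const.mul (ContinuousAt.cpow (ContinuousAt.inv₀ (by fun_prop) hne)
          continuousAt_const (Or.inl ?_))
        rw [Complex.inv_re]
        exact div_pos hAw (Complex.normSq_pos.mpr hne) }
  have := e.contractibleSpace
  infer_instance

/-- The bound ε ≤ π keeps u/v off the cut, where the argument would be discontinuous. -/
lemma isOpen_petalSector (hk : 1 ≤ k) (hv : v ≠ 0) {δ ε : ℝ} (hε : ε ≤ Real.pi) :
    IsOpen (petalSector A k δ ε v) := by
  rw [isOpen_iff_mem_nhds]
  intro u hu
  have hu0 := ne_zero_of_mem_petalSector hk hu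
  have hs : u / v ∈ Complex.slitPlane := by
    rw [Complex.mem_slitPlane_iff_arg]
    refine ⟨fun h => ?_, div_ne_zero hu0 hv⟩
    have := hu.2
    rw [h, abs_of_pos Real.pi_pos] at this
    linarith
  have h1 : ContinuousAt (fun u : ℂ => |(u / v).arg|) u := by
    have h2 : ContinuousAt (fun u : ℂ => u / v) u := by fun_prop
    exact (ContinuousAt.comp (f := fun u : ℂ => u / v) (Complex.continuousAt_arg hs) h2).abs
  have h2 : ContinuousAt (fun u : ℂ => ‖A * u ^ k + (δ : ℂ)‖) u := by fun_prop
  filter_upwards [h1.eventually_lt_const hu.2, h2.eventually_lt_const hu.1] with w hw1 hw2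
  exact ⟨hw2, hw1⟩

/-! ### Dynamics on the sectors -/

/-- The effect of `u ↦ u + A u^{k+1} + o(u^{k+1})` in the approximate Fatou coordinate. -/
lemma exists_fatou_step (hA : A ≠ 0) (hk : 1 ≤ k) {η : ℝ} (hη : 0 < η) :
    ∃ c > 0, ∃ r > 0, ∀ u u' : ℂ, u ≠ 0 → ‖u‖ < r →
      ‖u' - (u + A * u ^ (k + 1))‖ ≤ c * ‖u‖ ^ (k + 1) →
      u' ≠ 0 ∧ |(u' / u).arg| < η ∧ ‖fatou A k u' - fatou A k u - k‖ ≤ η := by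
  have hA0 := norm_pos_iff.mpr hA
  have hk' : (0 : ℝ) < k := by exact_mod_cast hk
  -- first order expansion of `(1 + x)^{-k}`
  have hder : HasDerivAt (fun x : ℂ => ((1 + x) ^ k)⁻¹) (-(k : ℂ)) 0 := by
    have h1 : HasDerivAt (fun x : ℂ => (1 + x) ^ k) ((k : ℂ) * (1 + 0) ^ (k - 1) * 1) 0 :=
      ((hasDerivAt_id (0 : ℂ)).const_add 1).pow k
    simpa using h1.fun_inv (by simp)
  set c₁ : ℝ := η * ‖A‖ / (2 * (‖A‖ + 1)) with hc₁
  have hc₁pos : 0 < c₁ := by positivity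
  have hE1 : ∀ᶠ x : ℂ in 𝓝 0, ‖((1 + x) ^ k)⁻¹ - 1 + k * x‖ ≤ c₁ * ‖x‖ := by
    have := (hasDerivAt_iff_isLittleO.mp hder).def hc₁pos
    filter_upwards [this] with x hx
    simpa [mul_comm] using hx
  have hE2 : ∀ᶠ x : ℂ in 𝓝 0, |(1 + x).arg| < η := by
    have h1 : ContinuousAt (fun x : ℂ => |(1 + x).arg|) 0 := by
      have h2 : ContinuousAt (fun x : ℂ => 1 + x) 0 := by fun_prop
      refine (ContinuousAt.comp (f := fun x : ℂ => 1 + x) (Complex.continuousAt_arg ?_) h2).abs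
      simp
    exact h1.eventually_lt_const (by simpa using hη)
  have hE3 : ∀ᶠ x : ℂ in 𝓝 0, 1 + x ≠ 0 := by
    have h2 : ContinuousAt (fun x : ℂ => 1 + x) 0 := by fun_prop
    exact h2.eventually_ne (by simp)
  obtain ⟨r₁, hr₁, hball⟩ := Metric.eventually_nhds_iff.mp (hE1.and (hE2.and hE3))
  -- The error bound is split in two halves: `c₁` pays for the second order remainder of (1+x)^(-k),
  -- and `c` for the perturbation, via kc ≤ η|A|/2. The bound c ≤ 1 controls x by (|A|+1)|u|^k.
  set c : ℝ := min 1 (η * ‖A‖ / (2 * k)) with hc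
  have hcpos : 0 < c := by positivity
  have hcle : k * c ≤ η * ‖A‖ / 2 := by
    have : c ≤ η * ‖A‖ / (2 * k) := min_le_right _ _
    calc k * c ≤ k * (η * ‖A‖ / (2 * k)) := by gcongr
      _ = η * ‖A‖ / 2 := by field_simp
  refine ⟨c, hcpos, min 1 (r₁ / (‖A‖ + 1)), by positivity, ?_⟩
  intro u u' hu hur hu'
  have hu0 : 0 < ‖u‖ := norm_pos_iff.mpr hu
  set x : ℂ := u' / u - 1 with hx
  set e : ℂ := x - A * u ^ k with he
  have hu'x : u' = u * (1 + x) := by rw [hx]; field_simp; ring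
  have heb : ‖e‖ ≤ c * ‖u‖ ^ k := by
    have : u' - (u + A * u ^ (k + 1)) = u * e := by rw [he, hu'x]; ring
    rw [this, norm_mul, pow_succ] at hu'
    refine le_of_mul_le_mul_left (a := ‖u‖) ?_ hu0
    linarith
  have hxb : ‖x‖ ≤ (‖A‖ + 1) * ‖u‖ ^ k := by
    have h1 : x = A * u ^ k + e := by rw [he]; ring
    have h2 : c ≤ 1 := min_le_left _ _
    calc ‖x‖ ≤ ‖A * u ^ k‖ + ‖e‖ := by rw [h1]; exact norm_add_le _ _
      _ ≤ ‖A‖ * ‖u‖ ^ k + 1 * ‖u‖ ^ k := by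
        rw [norm_mul, norm_pow]
        gcongr
        exact heb.trans (by gcongr)
      _ = _ := by ring
  have hxr : ‖x‖ < r₁ := by
    have h1 : ‖u‖ < 1 := lt_of_lt_of_le hur (min_le_left _ _)
    have h2 : ‖u‖ < r₁ / (‖A‖ + 1) := lt_of_lt_of_le hur (min_le_right _ _)
    have h3 : ‖u‖ ^ k ≤ ‖u‖ := pow_le_of_le_one hu0.le h1.le (by omega)
    rw [lt_div_iff₀ (by positivity)] at h2
    calc ‖x‖ ≤ (‖A‖ + 1) * ‖u‖ ^ k := hxb
      _ ≤ (‖A‖ + 1) * ‖u‖ := by gcongr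
      _ < r₁ := by linarith
  obtain ⟨h1, h2, h3⟩ := hball (y := x) (by simpa using hxr)
  have hdiv : u' / u = 1 + x := by rw [hx]; ring
  refine ⟨by rw [hu'x]; exact mul_ne_zero hu h3, by rw [hdiv]; exact h2, ?_⟩
  have hAu : A * u ^ k ≠ 0 := mul_ne_zero hA (pow_ne_zero _ hu)
  -- Write u' = u(1+x) with x = A u^k + e. Since `fatou A k u * (A * u ^ k) = -1`, the linear term
  -- -kx of (1+x)^(-k) produces the translation by k.
  have hid : fatou A k u' - fatou A k u - k =
      fatou A k u * ((((1 + x) ^ k)⁻¹ - 1 + k * x) - k * e) := by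
    have h5 : fatou A k u' = fatou A k u * ((1 + x) ^ k)⁻¹ := by
      rw [fatou, fatou, hu'x, mul_pow, ← mul_assoc, mul_inv, neg_mul]
    have h6 : fatou A k u * (A * u ^ k) = -1 := by
      rw [fatou, neg_mul, inv_mul_cancel₀ hAu]
    have h7 : e = x - A * u ^ k := he
    rw [h5, h7]
    linear_combination (-(k : ℂ)) * h6
  rw [hid, norm_mul, norm_fatou]
  have hpos : 0 < ‖A‖ * ‖u‖ ^ k := by positivity
  rw [inv_mul_le_iff₀ hpos]
  calc ‖(((1 + x) ^ k)⁻¹ - 1 + k * x) - k * e‖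
      ≤ ‖((1 + x) ^ k)⁻¹ - 1 + k * x‖ + ‖k * e‖ := norm_sub_le _ _
    _ ≤ c₁ * ((‖A‖ + 1) * ‖u‖ ^ k) + k * (c * ‖u‖ ^ k) := by
      rw [norm_mul, Complex.norm_natCast]
      gcongr
      exact h1.trans (by gcongr)
    _ = (η * ‖A‖ / 2 + k * c) * ‖u‖ ^ k := by rw [hc₁]; field_simp
    _ ≤ (η * ‖A‖ / 2 + η * ‖A‖ / 2) * ‖u‖ ^ k := by gcongr
    _ = ‖A‖ * ‖u‖ ^ k * η := by ring

/-- A perturbation of `u ↦ u + A u^{k+1}` maps the sectors into themselves. -/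
lemma exists_sector_step (hA : A ≠ 0) (hk : 1 ≤ k) {τ : ℝ} (hτ : 0 < τ) (hτ1 : τ ≤ 1) :
    ∃ c > 0, ∃ r > 0, ∀ v : ℂ, v ^ k = -((‖A‖ : ℂ) / A) → ∀ δ > 0, ∀ u u' : ℂ,
      u ∈ petalSector A k δ (Real.arctan τ / k) v → ‖u‖ < r →
      ‖u' - (u + A * u ^ (k + 1))‖ ≤ c * ‖u‖ ^ (k + 1) →
      u' ∈ petalSector A k δ (Real.arctan τ / k) v ∧
        (fatou A k u).re + 1 / 2 ≤ (fatou A k u').re := by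
  have hk' : (1 : ℝ) ≤ k := by exact_mod_cast hk
  have hpi := Real.pi_pos
  -- With η ≤ τ/2 the imaginary part moves by at most τ/2 while Re w gains at least 1/2, so the cone
  -- is kept. With η ≤ π/(2k) the argument of u/v stays below π/k, so no other branch is reached.
  obtain ⟨c, hc, r, hr, H⟩ := exists_fatou_step hA hk
    (η := min (τ / 2) (Real.pi / (2 * k))) (by positivity)
  refine ⟨c, hc, r, hr, fun v hv δ hδ u u' hu hur hu' => ?_⟩
  have hv0 := direction_ne_zero hA hk hv
  have hu0 := ne_zero_of_mem_petalSector hk hu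
  obtain ⟨hu'0, harg, hψ⟩ := H u u' hu0 hur hu'
  have hψ1 := hψ.trans (min_le_left _ _)
  have harg1 := harg.trans_le (min_le_right _ _)
  have huarg : |(u / v).arg| < Real.pi / (2 * k) := by
    refine hu.2.trans ?_
    rw [← div_div]
    gcongr
    exact Real.arctan_lt_pi_div_two τ
  obtain ⟨⟨h1, h2⟩, h3⟩ := (mem_petalSector_iff hA hk hv hδ).mp hu
  have hre := (Complex.abs_re_le_norm _).trans hψ1
  have him := (Complex.abs_im_le_norm _).trans hψ1
  simp only [Complex.sub_re, Complex.sub_im, Complex.natCast_re, Complex.natCast_im,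
    sub_zero] at hre him
  rw [abs_le] at hre him
  rw [abs_lt] at h2
  have hre' : (fatou A k u).re + 1 / 2 ≤ (fatou A k u').re := by linarith [hre.1]
  refine ⟨(mem_petalSector_iff hA hk hv hδ).mpr ⟨⟨by linarith, ?_⟩, ?_⟩, hre'⟩
  · rw [abs_lt]
    have := mul_le_mul_of_nonneg_left hre' hτ.le
    constructor <;> nlinarith [him.1, him.2]
  · have hmul : u' / v = (u' / u) * (u / v) := by field_simp
    have hhalf : Real.pi / (2 * k) + Real.pi / (2 * k) = Real.pi / k := by field_simp; ring
    have hle : Real.pi / k ≤ Real.pi := div_le_self hpi.le hk'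
    rw [abs_lt] at harg1 huarg
    have hsum : |(u' / u).arg + (u / v).arg| < Real.pi / k := by
      rw [abs_lt]
      constructor <;> linarith [harg1.1, harg1.2, huarg.1, huarg.2]
    rw [hmul, (Complex.arg_mul_eq_add_arg_iff (div_ne_zero hu'0 hu0)
      (div_ne_zero hu0 hv0)).mpr]
    · exact hsum
    · rw [abs_lt] at hsum
      exact ⟨by linarith [hsum.1], by linarith [hsum.2]⟩

lemma exists_petalSector_subset_ball (hA : A ≠ 0) (k : ℕ) {r : ℝ} (hr : 0 < r) :
    ∃ δ₀ > 0, ∀ δ ≤ δ₀, ∀ (ε : ℝ) (v u : ℂ), u ∈ petalSector A k δ ε v → ‖u‖ < r := by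
  have hA0 := norm_pos_iff.mpr hA
  refine ⟨‖A‖ * r ^ k / 2, by positivity, fun δ hδ ε v u hu => ?_⟩
  by_contra hc
  have h1 : r ^ k ≤ ‖u‖ ^ k := pow_le_pow_left₀ hr.le (not_lt.mp hc) k
  have h2 : ‖A * u ^ k‖ < 2 * δ := by
    have h3 : A * u ^ k = (A * u ^ k + (δ : ℂ)) - (δ : ℂ) := by ring
    have h4 := hu.1
    have h5 : 0 < δ := (norm_nonneg _).trans_lt h4
    calc ‖A * u ^ k‖ ≤ ‖A * u ^ k + (δ : ℂ)‖ + ‖(δ : ℂ)‖ := by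
          conv_lhs => rw [h3]
          exact norm_sub_le _ _
      _ < δ + δ := by
          rw [Complex.norm_real, Real.norm_of_nonneg h5.le]; linarith
      _ = 2 * δ := by ring
  rw [norm_mul, norm_pow] at h2
  have := mul_le_mul_of_nonneg_left h1 hA0.le
  linarith

lemma norm_le_of_mem_cone {R τ : ℝ} (hR : 0 ≤ R) (hτ1 : τ ≤ 1) {w : ℂ} (hw : w ∈ cone R τ) :
    ‖w‖ ≤ 2 * w.re := by
  have h0 : 0 < w.re := hR.trans_lt hw.1
  have h1 := Complex.norm_le_abs_re_add_abs_im w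
  have h2 := hw.2
  rw [abs_of_pos h0] at h1
  nlinarith

/-- In a cone with τ ≤ 1 one has |w| ≤ 2 Re w, so a small u already forces Re w to be large. Hence
shrinking δ amounts to intersecting with a neighborhood of 0, uniformly in the initial δ. -/
lemma exists_mem_petalSector_of_norm_lt (hA : A ≠ 0) (hk : 1 ≤ k) {τ : ℝ}
    (hτ1 : τ ≤ 1) {δ' : ℝ} (hδ' : 0 < δ') :
    ∃ r > 0, ∀ v : ℂ, v ^ k = -((‖A‖ : ℂ) / A) → ∀ δ > 0, ∀ u : ℂ,
      u ∈ petalSector A k δ (Real.arctan τ / k) v → ‖u‖ < r →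
      u ∈ petalSector A k δ' (Real.arctan τ / k) v := by
  have hA0 := norm_pos_iff.mpr hA
  refine ⟨min 1 (δ' / ‖A‖), by positivity, fun v hv δ hδ u hu hur => ?_⟩
  have hu0 := ne_zero_of_mem_petalSector hk hu
  obtain ⟨h1, h3⟩ := (mem_petalSector_iff hA hk hv hδ).mp hu
  refine (mem_petalSector_iff hA hk hv hδ').mpr ⟨⟨?_, h1.2⟩, h3⟩
  have h4 := norm_le_of_mem_cone (by positivity) hτ1 h1
  rw [norm_fatou] at h4
  have h5 : ‖A‖ * ‖u‖ ^ k < δ' := by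
    have h6 : ‖u‖ < 1 := hur.trans_le (min_le_left _ _)
    have h7 : ‖u‖ < δ' / ‖A‖ := hur.trans_le (min_le_right _ _)
    have h8 : ‖u‖ ^ k ≤ ‖u‖ := pow_le_of_le_one (norm_nonneg _) h6.le (by omega)
    rw [lt_div_iff₀ hA0] at h7
    nlinarith
  have hpos : 0 < ‖A‖ * ‖u‖ ^ k := by
    have := norm_pos_iff.mpr hu0
    positivity
  have h9 : δ'⁻¹ < (‖A‖ * ‖u‖ ^ k)⁻¹ := by gcongr
  rw [mul_inv]
  linarith

lemma tendsto_zero_of_tendsto_fatou (hA : A ≠ 0) {x : ℕ → ℂ}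
    (hx : Tendsto (fun q => (fatou A k (x q)).re) atTop atTop) : Tendsto x atTop (𝓝 0) := by
  have hA0 := norm_pos_iff.mpr hA
  rw [Metric.tendsto_nhds]
  intro r hr
  filter_upwards [hx.eventually_gt_atTop (‖A‖ * r ^ k)⁻¹] with q hq
  rw [dist_zero_right]
  by_contra hc
  have h1 : r ^ k ≤ ‖x q‖ ^ k := pow_le_pow_left₀ hr.le (not_lt.mp hc) k
  have h2 := hq.trans_le (Complex.re_le_norm _)
  rw [norm_fatou] at h2
  have : (‖A‖ * ‖x q‖ ^ k)⁻¹ ≤ (‖A‖ * r ^ k)⁻¹ := by gcongr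
  linarith

lemma tendsto_atTop_of_add_half_le {x : ℕ → ℝ} (hx : ∀ q, x q + 1 / 2 ≤ x (q + 1)) :
    Tendsto x atTop atTop := by
  have h : ∀ q : ℕ, x 0 + q * (1 / 2) ≤ x q := by
    intro q
    induction q with
    | zero => simp
    | succ q ih => push_cast; linarith [hx q]
  refine tendsto_atTop_mono h (tendsto_atTop_add_const_left _ _ ?_)
  exact tendsto_natCast_atTop_atTop.atTop_mul_const (by norm_num)

/-- By Cesàro w_q / q → κ > 0, and the argument ignores positive factors. -/
lemma tendsto_arg_zero {w : ℕ → ℂ} {κ : ℕ} (hκ : 1 ≤ κ)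
    (hw : Tendsto (fun q => w (q + 1) - w q) atTop (𝓝 (κ : ℂ))) :
    Tendsto (fun q => (w q).arg) atTop (𝓝 0) := by
  have h1 := hw.cesaro_smul
  have h2 : Tendsto (fun q : ℕ => (q : ℝ)⁻¹ • w 0) atTop (𝓝 0) := by
    simpa using (tendsto_inv_atTop_nhds_zero_nat (𝕜 := ℝ)).smul_const (w 0)
  have h3 : Tendsto (fun q : ℕ => (q : ℝ)⁻¹ • w q) atTop (𝓝 (κ : ℂ)) := by
    have := h1.add h2
    rw [add_zero] at this
    refine this.congr fun q => ?_
    rw [Finset.sum_range_sub, ← smul_add, sub_add_cancel]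
  have h4 : ContinuousAt Complex.arg (κ : ℂ) := by
    refine Complex.continuousAt_arg ?_
    left
    simp; omega
  have h5 := h4.tendsto.comp h3
  rw [Complex.natCast_arg] at h5
  refine h5.congr' ?_
  filter_upwards [eventually_gt_atTop 0] with q hq
  have : (0 : ℝ) < (q : ℝ)⁻¹ := by positivity
  simp only [Function.comp_apply, Complex.real_smul]
  exact Complex.arg_real_mul _ this

lemma zero_mem_closure_petalSector (hA : A ≠ 0) (hk : 1 ≤ k) (hv : v ^ k = -((‖A‖ : ℂ) / A))
    {τ δ : ℝ} (hτ : 0 < τ) (hδ : 0 < δ) :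
    (0 : ℂ) ∈ closure (petalSector A k δ (Real.arctan τ / k) v) := by
  set x : ℕ → ℂ := fun q => v * ((‖A‖ : ℂ) * ((q + 1 + (2 * δ)⁻¹ : ℝ) : ℂ))⁻¹ ^ ((k : ℂ)⁻¹)
  have hx : Tendsto x atTop (𝓝 0) := by
    refine tendsto_zero_of_tendsto_fatou (k := k) hA ?_
    simp only [x, fatou_cpow hA hk hv, Complex.ofReal_re]
    exact tendsto_atTop_add_const_right _ _
      (tendsto_atTop_add_const_right _ _ tendsto_natCast_atTop_atTop)
  refine mem_closure_of_tendsto hx (Eventually.of_forall fun q => ?_)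
  refine cpow_mem_petalSector hA hk hv hδ ⟨?_, ?_⟩
  · rw [Complex.ofReal_re]
    have : (0 : ℝ) ≤ q := by positivity
    linarith
  · rw [Complex.ofReal_re, Complex.ofReal_im, abs_zero]; positivity

/-- Small sectors are attracting petals. -/
lemma exists_isAttractingPetal (hA : A ≠ 0) (hk : 1 ≤ k) {τ : ℝ} (hτ : 0 < τ) (hτ1 : τ ≤ 1)
    {h : ℂ → ℂ} (ha : ∀ u, AnalyticAt ℂ h u)
    (hh : (fun u : ℂ => h u - (u + A * u ^ (k + 1))) =o[𝓝 0] fun u => ‖u‖ ^ (k + 1)) :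
    ∃ δ₀ > 0, ∀ δ, 0 < δ → δ ≤ δ₀ → ∀ v : ℂ, v ^ k = -((‖A‖ : ℂ) / A) →
      IsAttractingPetal h v (petalSector A k δ (Real.arctan τ / k) v) := by
  have hk' : (1 : ℝ) ≤ k := by exact_mod_cast hk
  have hbound : ∀ c > 0, ∀ᶠ u in 𝓝 (0 : ℂ),
      ‖h u - (u + A * u ^ (k + 1))‖ ≤ c * ‖u‖ ^ (k + 1) := by
    intro c hc
    filter_upwards [hh.def hc] with u hu
    simpa using hu
  obtain ⟨c, hc, r, hr, hstep⟩ := exists_sector_step hA hk hτ hτ1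
  obtain ⟨r', hr', hb⟩ := Metric.eventually_nhds_iff.mp (hbound c hc)
  obtain ⟨δ₀, hδ₀, hsub⟩ := exists_petalSector_subset_ball hA k (lt_min hr hr')
  refine ⟨δ₀, hδ₀, fun δ hδ hδle v hv => ?_⟩
  set S := petalSector A k δ (Real.arctan τ / k) v with hS
  have hv0 := direction_ne_zero hA hk hv
  have hone : ∀ u ∈ S, h u ∈ S ∧ (fatou A k u).re + 1 / 2 ≤ (fatou A k (h u)).re := by
    intro u hu
    have hlt := hsub δ hδle _ v u hu
    exact hstep v hv δ hδ u (h u) hu (hlt.trans_le (min_le_left _ _))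
      (hb (by simpa using hlt.trans_le (min_le_right _ _)))
  have hit : ∀ u ∈ S, ∀ q : ℕ, h^[q] u ∈ S := fun u hu q =>
    (Set.MapsTo.iterate (fun u hu => (hone u hu).1) q) hu
  have hre : ∀ u ∈ S, Tendsto (fun q : ℕ => (fatou A k (h^[q] u)).re) atTop atTop := by
    intro u hu
    refine tendsto_atTop_of_add_half_le fun q => ?_
    rw [Function.iterate_succ_apply']
    exact (hone _ (hit u hu q)).2
  have hzero : ∀ u ∈ S, Tendsto (fun q : ℕ => h^[q] u) atTop (𝓝 0) := fun u hu =>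
    tendsto_zero_of_tendsto_fatou hA (hre u hu)
  have hopen : IsOpen S := isOpen_petalSector hk hv0 (by
    have h1 := Real.arctan_lt_pi_div_two τ
    have h2 := Real.pi_pos
    rw [div_le_iff₀ (by linarith)]
    nlinarith)
  refine ⟨hopen, simplyConnectedSpace_petalSector hA hk hv hτ hδ, ?_, fun u _ => ha u,
    fun u hu => (hone u hu).1, hzero, fun u hu q => ne_zero_of_mem_petalSector hk (hit u hu q), ?_⟩
  · rw [hopen.frontier_eq]
    exact ⟨zero_mem_closure_petalSector hA hk hv hτ hδ,
      fun h0 => ne_zero_of_mem_petalSector hk h0 rfl⟩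
  · intro u hu
    -- As the orbit tends to 0, the step estimate applies eventually with every tolerance η, so the
    -- increments tend to k exactly. The direction of w then tends to 0, and with it that of u/v.
    have hdiff : Tendsto (fun q : ℕ => fatou A k (h^[q + 1] u) - fatou A k (h^[q] u)) atTop
        (𝓝 (k : ℂ)) := by
      rw [Metric.tendsto_nhds]
      intro η hη
      obtain ⟨c', hc', r₁, hr₁, hs⟩ := exists_fatou_step hA hk (half_pos hη)
      have hev := (hzero u hu).eventually
        ((hbound c' hc').and (Metric.ball_mem_nhds (0 : ℂ) hr₁))
      filter_upwards [hev] with q hq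
      have := (hs (h^[q] u) (h (h^[q] u)) (ne_zero_of_mem_petalSector hk (hit u hu q))
        (by simpa using hq.2) hq.1).2.2
      rw [Function.iterate_succ_apply', dist_eq_norm]
      linarith
    have harg := tendsto_arg_zero (w := fun q => fatou A k (h^[q] u)) hk hdiff
    have harg' : Tendsto (fun q : ℕ => (h^[q] u / v).arg) atTop (𝓝 0) := by
      refine squeeze_zero_norm (fun q => ?_) (tendsto_zero_iff_abs_tendsto_zero _ |>.mp harg)
      have h1 := (mem_petalSector_iff hA hk hv hδ).mp (hit u hu q)
      simp only [Function.comp_apply]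
      rw [Real.norm_eq_abs, abs_arg_fatou hA hk hv h1.2]
      nlinarith [abs_nonneg (h^[q] u / v).arg]
    -- Since |v| = 1, the unit vector of u is v exp(i Arg(u/v)).
    have hexp : Tendsto (fun q : ℕ => v * Complex.exp ((h^[q] u / v).arg * Complex.I)) atTop
        (𝓝 v) := by
      have hcont : Continuous fun x : ℝ => v * Complex.exp ((x : ℂ) * Complex.I) := by fun_prop
      simpa [Function.comp_def] using (hcont.tendsto 0).comp harg'
    refine hexp.congr fun q => ?_
    have hq0 := ne_zero_of_mem_petalSector hk (hit u hu q)
    have hn : (‖h^[q] u‖ : ℂ) ≠ 0 := by simpa using hq0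
    have h1 := Complex.norm_mul_exp_arg_mul_I (h^[q] u / v)
    rw [norm_div, norm_direction hA hk hv, div_one, eq_div_iff hv0] at h1
    rw [eq_div_iff hn]
    linear_combination h1

/-- A common point u would be both v and w times the same nonzero k-th root, which depends only on
the Fatou coordinate of u. -/
lemma disjoint_petalSector (hA : A ≠ 0) (hk : 1 ≤ k) {v w : ℂ}
    (hv : v ^ k = -((‖A‖ : ℂ) / A)) (hw : w ^ k = -((‖A‖ : ℂ) / A)) (hvw : v ≠ w) {τ δ : ℝ}
    (hδ : 0 < δ) :
    Disjoint (petalSector A k δ (Real.arctan τ / k) v)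
      (petalSector A k δ (Real.arctan τ / k) w) := by
  rw [Set.disjoint_left]
  intro u h1 h2
  have h0 := ne_zero_of_mem_petalSector hk h1
  have e1 := eq_of_mem_petalSector hA hk hv ((mem_petalSector_iff hA hk hv hδ).mp h1).2
  have e2 := eq_of_mem_petalSector hA hk hw ((mem_petalSector_iff hA hk hw hδ).mp h2).2
  refine hvw (mul_right_cancel₀ ?_ (e1.symm.trans e2))
  rintro h
  rw [h, mul_zero] at e1
  exact h0 e1

lemma exists_injective_roots (hk : 1 ≤ k) {c : ℂ} (hc : c ≠ 0) :
    ∃ v : Fin k → ℂ, Function.Injective v ∧ ∀ j, v j ^ k = c := by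
  have : NeZero k := ⟨by omega⟩
  have hζ := Complex.isPrimitiveRoot_exp k (by omega)
  set ζ := Complex.exp (2 * Real.pi * Complex.I / k)
  have hpow : (c ^ ((k : ℂ)⁻¹)) ^ k = c := Complex.cpow_nat_inv_pow c (by omega)
  have h0 : c ^ ((k : ℂ)⁻¹) ≠ 0 := by
    intro h
    rw [h, zero_pow (by omega)] at hpow
    exact hc hpow.symm
  refine ⟨fun j => c ^ ((k : ℂ)⁻¹) * ζ ^ (j : ℕ), fun i j hij => ?_, fun j => ?_⟩
  · exact Fin.ext (hζ.pow_inj i.2 j.2 (mul_left_cancel₀ h0 hij))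
  · rw [mul_pow, hpow, ← pow_mul, mul_comm (j : ℕ), pow_mul, hζ.pow_eq_one, one_pow, mul_one]

end

/-! ### The germ induced on u = z^α -/

section

variable {n : ℕ}

/-- `f = c (1 + b u^k) + O(u^{k+1})` is stable under products. -/
lemma isBigO_mul_expansion {k : ℕ} (hk : 1 ≤ k) {f g : ℂ → ℂ} {c d b e : ℂ}
    (hf : (fun u => f u - c * (1 + b * u ^ k)) =O[𝓝 0] fun u => ‖u‖ ^ (k + 1))
    (hg : (fun u => g u - d * (1 + e * u ^ k)) =O[𝓝 0] fun u => ‖u‖ ^ (k + 1)) :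
    (fun u => f u * g u - c * d * (1 + (b + e) * u ^ k)) =O[𝓝 0] fun u => ‖u‖ ^ (k + 1) := by
  have hT : ∀ c b : ℂ, (fun u : ℂ => c * (1 + b * u ^ k)) =O[𝓝 0] fun _ => (1 : ℝ) := by
    intro c b
    have : ContinuousAt (fun u : ℂ => c * (1 + b * u ^ k)) 0 := by fun_prop
    exact this.isBigO_one ℝ
  have hpow : ∀ {i j : ℕ}, j ≤ i → (fun u : ℂ => ‖u‖ ^ i) =O[𝓝 0] fun u => ‖u‖ ^ j := by
    intro i j hij
    refine IsBigO.of_bound 1 ?_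
    filter_upwards [Metric.ball_mem_nhds (0 : ℂ) one_pos] with z hz
    rw [mem_ball_zero_iff] at hz
    simp only [norm_pow, norm_norm, one_mul]
    exact pow_le_pow_of_le_one (norm_nonneg _) hz.le hij
  have hg1 : g =O[𝓝 0] fun _ => (1 : ℝ) := by
    have h1 := (hg.trans (hpow (Nat.zero_le (k + 1)))).congr_right (g₂ := fun _ => (1 : ℝ))
      (fun u => by simp)
    simpa using h1.add (hT d e)
  have h1 := (hf.mul hg1).congr_right (g₂ := fun u => ‖u‖ ^ (k + 1)) (fun u => by simp)
  have h2 := ((hT c b).mul hg).congr_right (g₂ := fun u => ‖u‖ ^ (k + 1)) (fun u => by simp)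
  have h3 : (fun u : ℂ => c * d * b * e * u ^ (k + k)) =O[𝓝 0] fun u => ‖u‖ ^ (k + 1) := by
    refine IsBigO.const_mul_left ?_ _
    refine IsBigO.trans (IsBigO.of_bound 1 (Eventually.of_forall fun u => ?_))
      (hpow (show k + 1 ≤ k + k by omega))
    simp
  refine ((h1.add h2).add h3).congr_left fun u => ?_
  rw [pow_add]
  ring

/-- The expansion of f is asked for only if i ≠ 0, because for the indices from m on, where α_j = 0,
`inducedGerm_expansion` does not know that λ_j can be divided by. -/
lemma isBigO_pow_expansion {k : ℕ} (hk : 1 ≤ k) {f : ℂ → ℂ} {c b : ℂ} (i : ℕ)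
    (hf : i ≠ 0 → (fun u => f u - c * (1 + b * u ^ k)) =O[𝓝 0] fun u => ‖u‖ ^ (k + 1)) :
    (fun u => f u ^ i - c ^ i * (1 + (i * b) * u ^ k)) =O[𝓝 0] fun u => ‖u‖ ^ (k + 1) := by
  rcases eq_or_ne i 0 with rfl | hi
  · simpa using isBigO_zero _ _
  replace hf := hf hi
  clear hi
  induction i with
  | zero => simpa using isBigO_zero _ _
  | succ i ih =>
    refine (isBigO_mul_expansion hk ih hf).congr_left fun u => ?_
    push_cast
    ring

lemma isBigO_prod_expansion {k : ℕ} (hk : 1 ≤ k) {ι : Type*} (s : Finset ι)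
    {f : ι → ℂ → ℂ} {c b : ι → ℂ}
    (hf : ∀ i, (fun u => f i u - c i * (1 + b i * u ^ k)) =O[𝓝 0] fun u => ‖u‖ ^ (k + 1)) :
    (fun u => ∏ i ∈ s, f i u - (∏ i ∈ s, c i) * (1 + (∑ i ∈ s, b i) * u ^ k)) =O[𝓝 0]
      fun u => ‖u‖ ^ (k + 1) := by
  classical
  induction s using Finset.induction_on with
  | empty => simpa using isBigO_zero _ _
  | insert i s hi ih =>
    refine (isBigO_mul_expansion hk (hf i) ih).congr_left fun u => ?_
    rw [Finset.prod_insert hi, Finset.prod_insert hi, Finset.sum_insert hi]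

/-- The germ `u ∏ⱼ g_j(u)^{α_j}` induced on `u = z^α` by a map with components
`z_j g_j(u)`. -/
noncomputable def inducedGerm (lam a : Fin n → ℂ) (α : Fin n → ℕ) (k : ℕ)
    (p : Fin n → Polynomial ℂ) (u : ℂ) : ℂ :=
  u * ∏ j, resFactor lam a k p j u ^ α j

lemma analyticAt_inducedGerm (lam a : Fin n → ℂ) (α : Fin n → ℕ) (k : ℕ)
    (p : Fin n → Polynomial ℂ) (u₀ : ℂ) : AnalyticAt ℂ (inducedGerm lam a α k p) u₀ :=
  analyticAt_id.mul (Finset.analyticAt_fun_prod _ fun j _ =>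
    (analyticAt_resFactor lam a k p j u₀).pow _)

/-- Each factor is λ_j^(α_j) (1 + α_j (a_j/λ_j) u^k + ...). The constants multiply to λ^α = 1 and
the coefficients of u^k add up to Λ. -/
lemma inducedGerm_expansion {lam a : Fin n → ℂ} {m : ℕ} {α : Fin n → ℕ} {k : ℕ}
    (hk : 1 ≤ k) (p : Fin n → Polynomial ℂ) (hα : ∀ j : Fin n, m ≤ (j : ℕ) → α j = 0)
    (hlam : ∀ j : Fin n, (j : ℕ) < m → lam j ≠ 0) (hmon : mon α lam = 1) :
    (fun u : ℂ => inducedGerm lam a α k p u - (u + bigLam lam m α a * u ^ (k + 1))) =O[𝓝 0]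
      fun u => ‖u‖ ^ (k + 2) := by
  have h1 : ∀ j, (fun u => resFactor lam a k p j u ^ α j -
      lam j ^ α j * (1 + (α j * (a j / lam j)) * u ^ k)) =O[𝓝 0] fun u => ‖u‖ ^ (k + 1) := by
    intro j
    refine isBigO_pow_expansion hk _ fun hj => ?_
    have hjm : (j : ℕ) < m := by
      by_contra hc
      exact hj (hα j (not_lt.mp hc))
    have hl := hlam j hjm
    have h2 : (fun u : ℂ => (p j).eval u) =O[𝓝 0] fun _ => (1 : ℝ) :=
      (p j).continuous.continuousAt.isBigO_one ℝ
    have h3 : (fun u : ℂ => u ^ (k + 1)) =O[𝓝 0] fun u => ‖u‖ ^ (k + 1) :=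
      IsBigO.of_bound 1 (Eventually.of_forall fun u => by simp)
    refine (h3.mul h2).congr (fun u => ?_) fun u => by simp
    rw [resFactor]
    field_simp
    ring
  have h2 := isBigO_prod_expansion hk Finset.univ h1
  have h3 : ∏ j, lam j ^ α j = 1 := hmon
  have h4 : ∑ j, (α j * (a j / lam j)) = bigLam lam m α a := by
    unfold bigLam
    refine Finset.sum_congr rfl fun j _ => ?_
    split_ifs with hj
    · ring
    · rw [hα j (not_lt.mp hj)]; simp
  rw [h3, h4] at h2
  have h5 : (fun u : ℂ => u) =O[𝓝 0] fun u => ‖u‖ :=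
    IsBigO.of_bound 1 (Eventually.of_forall fun u => by simp)
  refine (h5.mul h2).congr (fun u => ?_) fun u => ?_
  · rw [inducedGerm]; ring
  · ring

lemma IsNormalUpTo.mon_comp {G : (Fin n → ℂ) → (Fin n → ℂ)} {lam : Fin n → ℂ} {m : ℕ}
    {α : Fin n → ℕ} {k : ℕ} {a : Fin n → ℂ} {p : Fin n → Polynomial ℂ} {N : ℕ}
    (hG : IsNormalUpTo G lam m α k a p N) (hGd : IsGermDiffeo G)
    (hα : ∀ j : Fin n, m ≤ (j : ℕ) → α j = 0) :
    (fun z : Fin n → ℂ => mon α (G z) - inducedGerm lam a α k p (mon α z)) =O[𝓝 0]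
      fun z => ‖z‖ ^ N := by
  -- Components from m on are not in normal form but do not enter the monomial; replacing them by 0
  -- makes x - y small in every component, and the monomial is Lipschitz near 0.
  set x : (Fin n → ℂ) → (Fin n → ℂ) := fun z j => if (j : ℕ) < m then G z j else 0 with hx
  set y : (Fin n → ℂ) → (Fin n → ℂ) := fun z j =>
    if (j : ℕ) < m then z j * resFactor lam a k p j (mon α z) else 0 with hy
  have hpow : ∀ (c d : ℂ) (j : Fin n), (if (j : ℕ) < m then c else d) ^ α j = c ^ α j := by
    intro c d j
    split_ifs with hj
    · rfl
    · rw [hα j (not_lt.mp hj), pow_zero, pow_zero]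
  have hmx : ∀ z, mon α (x z) = mon α (G z) := fun z =>
    Finset.prod_congr rfl fun j _ => hpow _ _ _
  have hmy : ∀ z, mon α (y z) = inducedGerm lam a α k p (mon α z) := by
    intro z
    have : mon α (y z) = ∏ j, (z j * resFactor lam a k p j (mon α z)) ^ α j :=
      Finset.prod_congr rfl fun j _ => hpow _ _ _
    rw [this, inducedGerm]
    simp only [mul_pow, Finset.prod_mul_distrib]
    rfl
  have hxt : Tendsto x (𝓝 0) (𝓝 0) := by
    rw [tendsto_pi_nhds]
    intro j
    have := (tendsto_pi_nhds.mp hGd.tendsto) j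
    by_cases hj : (j : ℕ) < m <;> simp only [hx, hj, if_true, if_false]
    · exact this
    · exact tendsto_const_nhds
  have hyt : Tendsto y (𝓝 0) (𝓝 0) := by
    rw [tendsto_pi_nhds]
    intro j
    have h1 : ContinuousAt (fun z : Fin n → ℂ => z j * resFactor lam a k p j (mon α z)) 0 :=
      (continuous_apply j).continuousAt.mul (ContinuousAt.comp
        (analyticAt_resFactor lam a k p j _).continuousAt (continuous_mon α).continuousAt)
    by_cases hj : (j : ℕ) < m <;> simp only [hy, hj, if_true, if_false]
    · simpa [ContinuousAt] using h1.tendsto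
    · exact tendsto_const_nhds
  have hxy : (fun z => x z - y z) =O[𝓝 0] fun z => ‖z‖ ^ N := by
    refine isBigO_pi.mpr fun j => ?_
    by_cases hj : (j : ℕ) < m
    · simpa only [hx, hy, Pi.sub_apply, hj, if_true] using hG j hj
    · simpa only [hx, hy, Pi.sub_apply, hj, if_false, sub_zero] using isBigO_zero _ _
  have h1 := (analyticAt_mon α 0).hasStrictFDerivAt.isBigO_sub.comp_tendsto
    (hxt.prodMk_nhds hyt)
  refine (h1.trans hxy).congr_left fun z => ?_
  simp only [Function.comp_apply, hmx, hmy]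

/-! ### Invariance of the conditions |z_i| < |u|^β -/

/-- Error terms on the region `‖z‖ ≤ ‖u‖ ^ β`. -/
lemma eventually_norm_le_rpow {E : Type*} [NormedAddCommGroup E] {f : (Fin n → ℂ) → E} {N : ℕ}
    (hf : f =O[𝓝 0] fun z => ‖z‖ ^ N) {β e c : ℝ} (hβ : 0 < β) (he : e < β * N)
    (hc : 0 < c) :
    ∀ᶠ u in 𝓝 (0 : ℂ), u ≠ 0 → ∀ z : Fin n → ℂ, ‖z‖ ≤ ‖u‖ ^ β → ‖f z‖ ≤ c * ‖u‖ ^ e := by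
  obtain ⟨C, hC, hfC⟩ := hf.exists_pos
  obtain ⟨ρ, hρ, hball⟩ := Metric.eventually_nhds_iff.mp hfC.bound
  have ht : ∀ s : ℝ, 0 < s → Tendsto (fun u : ℂ => ‖u‖ ^ s) (𝓝 0) (𝓝 0) := by
    intro s hs
    have h1 : ContinuousAt (fun u : ℂ => ‖u‖ ^ s) 0 :=
      continuous_norm.continuousAt.rpow_const (Or.inr hs.le)
    simpa [ContinuousAt, Real.zero_rpow hs.ne'] using h1.tendsto
  filter_upwards [(ht β hβ).eventually_lt_const hρ,
    (ht (β * N - e) (by linarith)).eventually_lt_const (show 0 < c / C by positivity)]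
    with u hu1 hu2 hu0 z hz
  have hu : 0 < ‖u‖ := norm_pos_iff.mpr hu0
  have h1 := hball (y := z) (by simpa using hz.trans_lt hu1)
  rw [norm_pow, norm_norm] at h1
  rw [lt_div_iff₀ hC] at hu2
  calc ‖f z‖ ≤ C * ‖z‖ ^ N := h1
    _ ≤ C * (‖u‖ ^ β) ^ N := by gcongr
    _ = (‖u‖ ^ (β * N - e) * C) * ‖u‖ ^ e := by
      rw [← Real.rpow_natCast, ← Real.rpow_mul hu.le, mul_comm _ C, mul_assoc,
        ← Real.rpow_add hu, sub_add_cancel]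
    _ ≤ c * ‖u‖ ^ e := by gcongr

lemma eventually_norm_one_add_le {c : ℝ} (hc : 0 < c) :
    ∀ᶠ w in 𝓝 (0 : ℂ), ‖1 + w‖ ≤ 1 + w.re + c * ‖w‖ := by
  have hr : 0 < min (1 / 2) c := by positivity
  filter_upwards [Metric.ball_mem_nhds (0 : ℂ) hr] with w hw
  rw [mem_ball_zero_iff] at hw
  have h1 := hw.trans_le (min_le_left _ _)
  have h2 := hw.trans_le (min_le_right _ _)
  have h3 := abs_le.mp (Complex.abs_re_le_norm w)
  have h4 := norm_nonneg w
  have h5 : 0 ≤ 1 + w.re + c * ‖w‖ := by nlinarith [h3.1]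
  refine le_of_sq_le_sq ?_ h5
  have h6 : w.im ^ 2 ≤ ‖w‖ ^ 2 := by
    rw [← sq_abs]
    exact pow_le_pow_left₀ (abs_nonneg _) (Complex.abs_im_le_norm w) 2
  rw [← Complex.normSq_eq_norm_sq, Complex.normSq_apply]
  simp only [Complex.add_re, Complex.one_re, Complex.add_im, Complex.one_im, zero_add]
  have h7 : 0 ≤ c * ‖w‖ := by positivity
  nlinarith [h3.1, mul_le_mul_of_nonneg_right h2.le h4,
    mul_nonneg (show 0 ≤ 1 + w.re - 1 / 2 by linarith [h3.1]) h7]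

lemma eventually_le_norm_one_add_rpow (β : ℝ) (hβ : 0 < β) {c : ℝ} (hc : 0 < c) :
    ∀ᶠ x in 𝓝 (0 : ℂ), 1 + β * x.re - c * ‖x‖ ≤ ‖1 + x‖ ^ β := by
  have hd : HasDerivAt (fun y : ℝ => y ^ β) β 1 := by
    simpa using Real.hasDerivAt_rpow_const (x := 1) (p := β) (Or.inl one_ne_zero)
  have h1 := (hasDerivAt_iff_isLittleO.mp hd).def hc
  have ht : Tendsto (fun x : ℂ => ‖1 + x‖) (𝓝 0) (𝓝 1) := by
    have : ContinuousAt (fun x : ℂ => ‖1 + x‖) 0 := by fun_prop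
    simpa [ContinuousAt] using this.tendsto
  filter_upwards [ht.eventually h1] with x hx
  have h2 : |‖1 + x‖ - 1| ≤ ‖x‖ := by
    have := abs_norm_sub_norm_le (1 + x) 1
    simpa using this
  have h3 : 1 + x.re ≤ ‖1 + x‖ := by
    simpa using Complex.re_le_norm (1 + x)
  simp only [Real.one_rpow, smul_eq_mul, Real.norm_eq_abs] at hx
  have h4 := (abs_le.mp hx).1
  nlinarith [mul_le_mul_of_nonneg_left h2 hc.le]

/-- The new bound |u'|^β against which the image coordinates are compared: u' = u(1+x) with x close
to A u^k, and |1+x|^β ≥ 1 + β Re x - o(|x|). -/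
lemma exists_le_norm_rpow (A : ℂ) {k : ℕ} (hk : 1 ≤ k) {β c : ℝ} (hβ : 0 < β) (hc : 0 < c) :
    ∃ c' > 0, ∀ᶠ u in 𝓝 (0 : ℂ), u ≠ 0 → ∀ u' : ℂ,
      ‖u' - (u + A * u ^ (k + 1))‖ ≤ c' * ‖u‖ ^ (k + 1) →
      ‖u‖ ^ β * (1 + β * (A * u ^ k).re - c * ‖u‖ ^ k) ≤ ‖u'‖ ^ β := by
  set c₁ : ℝ := c / (2 * (‖A‖ + 1)) with hc₁
  have hc₁pos : 0 < c₁ := by positivity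
  set c' : ℝ := min 1 (c / (2 * β)) with hc'
  have hc'pos : 0 < c' := by positivity
  obtain ⟨r, hr, hball⟩ := Metric.eventually_nhds_iff.mp
    (eventually_le_norm_one_add_rpow β hβ hc₁pos)
  have ht : Tendsto (fun u : ℂ => (‖A‖ + 1) * ‖u‖ ^ k) (𝓝 0) (𝓝 0) := by
    have : ContinuousAt (fun u : ℂ => (‖A‖ + 1) * ‖u‖ ^ k) 0 := by fun_prop
    simpa [ContinuousAt, show k ≠ 0 by omega] using this.tendsto
  refine ⟨c', hc'pos, ?_⟩
  filter_upwards [ht.eventually_lt_const hr] with u hur hu u' hu'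
  have hu0 : 0 < ‖u‖ := norm_pos_iff.mpr hu
  set x : ℂ := u' / u - 1 with hx
  set e : ℂ := x - A * u ^ k with he
  have hu'x : u' = u * (1 + x) := by rw [hx]; field_simp; ring
  have heb : ‖e‖ ≤ c' * ‖u‖ ^ k := by
    have : u' - (u + A * u ^ (k + 1)) = u * e := by rw [he, hu'x]; ring
    rw [this, norm_mul, pow_succ] at hu'
    refine le_of_mul_le_mul_left (a := ‖u‖) ?_ hu0
    linarith
  have hxe : x = A * u ^ k + e := by rw [he]; ring
  have hxb : ‖x‖ ≤ (‖A‖ + 1) * ‖u‖ ^ k := by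
    have h2 : c' ≤ 1 := min_le_left _ _
    calc ‖x‖ ≤ ‖A * u ^ k‖ + ‖e‖ := by rw [hxe]; exact norm_add_le _ _
      _ ≤ ‖A‖ * ‖u‖ ^ k + 1 * ‖u‖ ^ k := by
        rw [norm_mul, norm_pow]
        gcongr
        exact heb.trans (by gcongr)
      _ = _ := by ring
  have h1 := hball (y := x) (by simpa using hxb.trans_lt hur)
  rw [hu'x, norm_mul, Real.mul_rpow hu0.le (norm_nonneg _)]
  refine mul_le_mul_of_nonneg_left (le_trans ?_ h1) (by positivity)
  have h2 : β * c' ≤ c / 2 := by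
    calc β * c' ≤ β * (c / (2 * β)) := by gcongr; exact min_le_right _ _
      _ = c / 2 := by field_simp
  have h3 : c₁ * ((‖A‖ + 1) * ‖u‖ ^ k) = c / 2 * ‖u‖ ^ k := by rw [hc₁]; field_simp
  have h4 : -(c' * ‖u‖ ^ k) ≤ e.re :=
    (neg_le_neg heb).trans (abs_le.mp (Complex.abs_re_le_norm e)).1
  have h5 : x.re = (A * u ^ k).re + e.re := by rw [hxe]; simp
  rw [h5]
  have h6 := mul_le_mul_of_nonneg_left h4 hβ.le
  have h7 := mul_le_mul_of_nonneg_left hxb hc₁pos.le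
  have h8 := mul_le_mul_of_nonneg_right h2 (show 0 ≤ ‖u‖ ^ k by positivity)
  linarith

lemma eventually_norm_resFactor_le {lam a : Fin n → ℂ} {k : ℕ} (hk : 1 ≤ k)
    (p : Fin n → Polynomial ℂ) {j : Fin n} (hj : ‖lam j‖ = 1) {A : ℂ} (hA : A ≠ 0) {c : ℝ}
    (hc : 0 < c) :
    ∀ᶠ u in 𝓝 (0 : ℂ), ‖resFactor lam a k p j u‖ ≤
      1 + ((a j * (lam j)⁻¹ * A⁻¹) * (A * u ^ k)).re + c * ‖u‖ ^ k := by
  have hl : lam j ≠ 0 := by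
    intro h; rw [h, norm_zero] at hj; exact zero_ne_one hj
  set w : ℂ → ℂ := fun u => a j * (lam j)⁻¹ * A⁻¹ * (A * u ^ k) with hw
  have hwt : Tendsto w (𝓝 0) (𝓝 0) := by
    have : ContinuousAt w 0 := by fun_prop
    simpa [ContinuousAt, hw, show k ≠ 0 by omega] using this.tendsto
  have hpt : Tendsto (fun u : ℂ => ‖u * (p j).eval u‖) (𝓝 0) (𝓝 0) := by
    have : ContinuousAt (fun u : ℂ => ‖u * (p j).eval u‖) 0 :=
      (continuousAt_id.mul (p j).continuous.continuousAt).norm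
    simpa [ContinuousAt] using this.tendsto
  set c₁ : ℝ := c / (2 * (‖a j‖ + 1)) with hc₁
  have hc₁pos : 0 < c₁ := by positivity
  filter_upwards [hwt.eventually (eventually_norm_one_add_le hc₁pos),
    hpt.eventually_lt_const (half_pos hc)] with u hu1 hu2
  have h1 : resFactor lam a k p j u = lam j * (1 + w u) + u ^ k * (u * (p j).eval u) := by
    rw [resFactor, hw]
    field_simp
    ring
  have h2 : ‖w u‖ ≤ (‖a j‖ + 1) * ‖u‖ ^ k := by
    have : w u = a j * (lam j)⁻¹ * u ^ k := by rw [hw]; field_simp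
    rw [this, norm_mul, norm_mul, norm_inv, hj, norm_pow]
    have : 0 ≤ ‖u‖ ^ k := by positivity
    nlinarith
  have h3 : c₁ * ((‖a j‖ + 1) * ‖u‖ ^ k) = c / 2 * ‖u‖ ^ k := by rw [hc₁]; field_simp
  calc ‖resFactor lam a k p j u‖ ≤ ‖lam j * (1 + w u)‖ + ‖u ^ k * (u * (p j).eval u)‖ := by
        rw [h1]; exact norm_add_le _ _
    _ ≤ (1 + (w u).re + c₁ * ‖w u‖) + ‖u‖ ^ k * (c / 2) := by
        rw [norm_mul, hj, one_mul, norm_mul, norm_pow]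
        gcongr
    _ ≤ (1 + (w u).re + c₁ * ((‖a j‖ + 1) * ‖u‖ ^ k)) + ‖u‖ ^ k * (c / 2) := by gcongr
    _ = _ := by rw [h3]; ring

/-- Parabolic attraction does its work here. After multiplication by |w|², the gain is Re b Re w.
Half of it absorbs Im b Im w (narrow cone), a quarter absorbs β Re w, and the last quarter gives the
margin through |w| ≤ 2 Re w. -/
lemma re_mul_le_of_mem_cone {R τ β : ℝ} (hR : 0 ≤ R) (hτ1 : τ ≤ 1) {b w : ℂ}
    (hb : 0 < b.re) (hbτ : τ * |b.im| ≤ b.re / 2) (hbβ : β ≤ b.re / 4) (hw : w ∈ cone R τ) :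
    (b * -w⁻¹).re ≤ β * (-w⁻¹).re - b.re / 8 * ‖w⁻¹‖ := by
  have h0 : 0 < w.re := hR.trans_lt hw.1
  have hw0 : w ≠ 0 := by rintro rfl; simp at h0
  have hn : 0 < Complex.normSq w := Complex.normSq_pos.mpr hw0
  have h1 := norm_le_of_mem_cone hR hτ1 hw
  have h2 : ‖w⁻¹‖ = ‖w‖ / Complex.normSq w := by
    rw [norm_inv, Complex.normSq_eq_norm_sq]
    have := norm_pos_iff.mpr hw0
    field_simp
  have h3 : -(b.im * w.im) ≤ b.re / 2 * w.re := by
    calc -(b.im * w.im) ≤ |b.im * w.im| := neg_le_abs _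
      _ = |b.im| * |w.im| := abs_mul _ _
      _ ≤ |b.im| * (τ * w.re) := by gcongr; exact hw.2.le
      _ = (τ * |b.im|) * w.re := by ring
      _ ≤ b.re / 2 * w.re := by gcongr
  rw [h2]
  simp only [Complex.mul_re, Complex.neg_re, Complex.neg_im, Complex.inv_re, Complex.inv_im]
  have : b.re * -(w.re / Complex.normSq w) - b.im * -(-w.im / Complex.normSq w) =
      (-(b.re * w.re) - b.im * w.im) / Complex.normSq w := by ring
  rw [this]
  have : β * -(w.re / Complex.normSq w) - b.re / 8 * (‖w‖ / Complex.normSq w) =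
      (-(β * w.re) - b.re / 8 * ‖w‖) / Complex.normSq w := by ring
  rw [this]
  refine div_le_div_of_nonneg_right ?_ hn.le
  nlinarith

lemma norm_le_of_mem_basinOver {α : Fin n → ℕ} {β : ℝ} {S : Set ℂ} {z : Fin n → ℂ}
    (hz : z ∈ basinOver α β S) : ‖z‖ ≤ ‖mon α z‖ ^ β :=
  (pi_norm_le_iff_of_nonneg (by positivity)).mpr fun i => (hz.2 i).le

lemma basinOver_mono {α : Fin n → ℕ} {β : ℝ} {S T : Set ℂ} (hST : S ⊆ T) :
    basinOver α β S ⊆ basinOver α β T := fun _ hz => ⟨hST hz.1, hz.2⟩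

/-- A germ in normal form maps the sets over small sectors into themselves. -/
lemma exists_basin_step {G : (Fin n → ℂ) → (Fin n → ℂ)} {lam : Fin n → ℂ} {m : ℕ}
    {α : Fin n → ℕ} {k : ℕ} {a : Fin n → ℂ} {p : Fin n → Polynomial ℂ} {N : ℕ} {h : ℂ → ℂ}
    {τ β : ℝ} {A : ℂ} (hA : A ≠ 0) (hk : 1 ≤ k) (hτ : 0 < τ) (hτ1 : τ ≤ 1) (hβ : 0 < β)
    (hβ1 : β < 1) (hN : (k : ℝ) + 1 < β * N) (hG : IsLeadingForm G lam m α k a)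
    (hnorm : IsNormalUpTo G lam m α k a p N)
    (hh : (fun u : ℂ => h u - (u + A * u ^ (k + 1))) =o[𝓝 0] fun u => ‖u‖ ^ (k + 1))
    (hGh : (fun z : Fin n → ℂ => mon α (G z) - h (mon α z)) =O[𝓝 0] fun z => ‖z‖ ^ N)
    (hpar : ∀ j : Fin n, (j : ℕ) < m → ‖lam j‖ = 1 ∧ 0 < (a j * (lam j)⁻¹ * A⁻¹).re ∧
      τ * |(a j * (lam j)⁻¹ * A⁻¹).im| ≤ (a j * (lam j)⁻¹ * A⁻¹).re / 2 ∧
      β ≤ (a j * (lam j)⁻¹ * A⁻¹).re / 4)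
    (hattr : ∀ j : Fin n, m ≤ (j : ℕ) → ‖lam j‖ < 1) :
    ∃ r > 0, ∀ v : ℂ, v ^ k = -((‖A‖ : ℂ) / A) → ∀ δ > 0,
      ∀ z ∈ basinOver α β (petalSector A k δ (Real.arctan τ / k) v), ‖mon α z‖ < r →
        G z ∈ basinOver α β (petalSector A k δ (Real.arctan τ / k) v) ∧
        (fatou A k (mon α z)).re + 1 / 2 ≤ (fatou A k (mon α (G z))).re := by
  have hA0 := norm_pos_iff.mpr hA
  -- the map induced on `u`
  have herr : ∀ c > 0, ∀ᶠ u in 𝓝 (0 : ℂ), u ≠ 0 → ∀ z : Fin n → ℂ, mon α z = u →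
      ‖z‖ ≤ ‖u‖ ^ β → ‖mon α (G z) - (u + A * u ^ (k + 1))‖ ≤ c * ‖u‖ ^ (k + 1) := by
    intro c hc
    filter_upwards [eventually_norm_le_rpow hGh hβ hN (half_pos hc), hh.def (half_pos hc)]
      with u h1 h2 hu z hzu hz
    have h3 := h1 hu z hz
    rw [hzu, ← Nat.cast_add_one, Real.rpow_natCast] at h3
    rw [norm_pow, norm_norm] at h2
    calc ‖mon α (G z) - (u + A * u ^ (k + 1))‖
        = ‖(mon α (G z) - h u) + (h u - (u + A * u ^ (k + 1)))‖ := by congr 1; ring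
      _ ≤ ‖mon α (G z) - h u‖ + ‖h u - (u + A * u ^ (k + 1))‖ := norm_add_le _ _
      _ ≤ c * ‖u‖ ^ (k + 1) := by linarith
  -- Using `cone 0 τ` keeps the radius independent of δ, so that all smaller sectors are handled at
  -- once.
  have hcoord : ∀ j : Fin n, ∀ᶠ u in 𝓝 (0 : ℂ), u ≠ 0 → fatou A k u ∈ cone 0 τ →
      ∀ z : Fin n → ℂ, mon α z = u → ‖z‖ ≤ ‖u‖ ^ β → ‖G z j‖ < ‖mon α (G z)‖ ^ β := by
    intro j
    rcases lt_or_ge (j : ℕ) m with hj | hj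
    · obtain ⟨hl, hb, hbτ, hbβ⟩ := hpar j hj
      set b : ℂ := a j * (lam j)⁻¹ * A⁻¹ with hbdef
      -- κ|u|^k is the margin from `re_mul_le_of_mem_cone`. Three errors of size κ/4 are charged to
      -- it: the bound for |u'|^β, the multiplier of z_j, and the normal form remainder. The latter
      -- is measured against |u|^(β+k), which β < 1 and k + 1 < βN allow.
      set κ : ℝ := b.re / 8 * ‖A‖ with hκ
      have hκpos : 0 < κ := by positivity
      have hc : 0 < κ / 4 := by positivity
      obtain ⟨c', hc', hlow⟩ := exists_le_norm_rpow A hk hβ hc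
      filter_upwards [hlow, herr c' hc', eventually_norm_resFactor_le hk p hl hA hc,
        eventually_norm_le_rpow (hnorm j hj) hβ (show β + k < β * N by linarith) hc]
        with u h1 h2 h3 h4 hu hcone z hzu hz
      have hu0 : 0 < ‖u‖ := norm_pos_iff.mpr hu
      have h5 := h1 hu _ (h2 hu z hzu hz)
      have h6 := h4 hu z hz
      rw [hzu, Real.rpow_add hu0, Real.rpow_natCast] at h6
      have h7 := re_mul_le_of_mem_cone le_rfl hτ1 hb hbτ hbβ hcone
      rw [← mul_pow_eq_neg_inv_fatou] at h7
      have h8 : ‖(fatou A k u)⁻¹‖ = ‖A‖ * ‖u‖ ^ k := by rw [norm_inv, norm_fatou, inv_inv]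
      rw [h8] at h7
      have hy : 0 < ‖u‖ ^ β := by positivity
      have hs : 0 < ‖u‖ ^ k := by positivity
      set y := ‖u‖ ^ β
      set s := ‖u‖ ^ k
      refine lt_of_lt_of_le ?_ h5
      have h9 : ‖G z j‖ ≤ ‖z j‖ * ‖resFactor lam a k p j u‖ + κ / 4 * (y * s) := by
        calc ‖G z j‖ = ‖z j * resFactor lam a k p j u +
                (G z j - z j * resFactor lam a k p j u)‖ := by
              congr 1; ring
          _ ≤ ‖z j * resFactor lam a k p j u‖ + ‖G z j - z j * resFactor lam a k p j u‖ :=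
              norm_add_le _ _
          _ ≤ _ := by rw [norm_mul]; linarith
      have h10 : ‖z j‖ * ‖resFactor lam a k p j u‖ ≤
          y * (1 + (b * (A * u ^ k)).re + κ / 4 * s) :=
        mul_le_mul ((norm_le_pi_norm z j).trans hz) h3 (norm_nonneg _) hy.le
      have h11 : y * (1 + (b * (A * u ^ k)).re + κ / 4 * s) ≤
          y * (1 + (β * (A * u ^ k).re - b.re / 8 * (‖A‖ * s)) + κ / 4 * s) := by gcongr
      have h12 : b.re / 8 * (‖A‖ * s) = κ * s := by rw [hκ]; ring
      rw [h12] at h11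
      have h13 : 0 < κ * (y * s) := by positivity
      nlinarith
    · have hl := hattr j hj
      -- With |λ_j| = 1 - 4q, the image coordinate is at most (1 - 3q)|u|^β, while |u'|^β is at
      -- least (1 - q)|u|^β.
      set q : ℝ := (1 - ‖lam j‖) / 4 with hq
      have hqpos : 0 < q := by rw [hq]; linarith
      have hlin : (fun z => G z j - lam j * z j) =O[𝓝 0] fun z => ‖z‖ ^ 2 := by
        have := isBigO_pi.mp (analyticAt_linear_approx hG.diffeo.analytic hG.diffeo.map_zero) j
        refine this.congr_left fun z => ?_
        rw [Pi.sub_apply, hG.diagonal]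
      obtain ⟨c', hc', hlow⟩ := exists_le_norm_rpow A hk hβ one_pos
      have ht : Tendsto (fun u : ℂ => β * (A * u ^ k).re - 1 * ‖u‖ ^ k) (𝓝 0) (𝓝 0) := by
        have : ContinuousAt (fun u : ℂ => β * (A * u ^ k).re - 1 * ‖u‖ ^ k) 0 := by fun_prop
        simpa [ContinuousAt, show k ≠ 0 by omega] using this.tendsto
      filter_upwards [hlow, herr c' hc', ht.eventually_const_lt (neg_lt_zero.mpr hqpos),
        eventually_norm_le_rpow hlin hβ (show β < β * (2 : ℕ) by push_cast; linarith) hqpos]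
        with u h1 h2 h3 h4 hu _ z hzu hz
      have hu0 : 0 < ‖u‖ := norm_pos_iff.mpr hu
      have h5 := h1 hu _ (h2 hu z hzu hz)
      have h6 := h4 hu z hz
      have hy : 0 < ‖u‖ ^ β := by positivity
      set y := ‖u‖ ^ β
      refine lt_of_lt_of_le ?_ h5
      have h9 : ‖G z j‖ ≤ ‖lam j‖ * y + q * y := by
        calc ‖G z j‖ = ‖lam j * z j + (G z j - lam j * z j)‖ := by congr 1; ring
          _ ≤ ‖lam j * z j‖ + ‖G z j - lam j * z j‖ := norm_add_le _ _
          _ ≤ _ := by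
            rw [norm_mul]
            gcongr
            exact (norm_le_pi_norm z j).trans hz
      have h10 : y * (1 - q) ≤ y * (1 + β * (A * u ^ k).re - 1 * ‖u‖ ^ k) := by
        refine mul_le_mul_of_nonneg_left ?_ hy.le
        linarith
      have h11 : ‖lam j‖ = 1 - 4 * q := by rw [hq]; ring
      rw [h11] at h9
      nlinarith [mul_pos hqpos hy]
  obtain ⟨c, hc, r₀, hr₀, hsec⟩ := exists_sector_step hA hk hτ hτ1
  obtain ⟨r₁, hr₁, hball⟩ := Metric.eventually_nhds_iff.mp
    ((herr c hc).and (eventually_all.mpr hcoord))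
  refine ⟨min r₀ r₁, lt_min hr₀ hr₁, fun v hv δ hδ z hz hzr => ?_⟩
  obtain ⟨h1, h2⟩ := hball (y := mon α z) (by simpa using hzr.trans_le (min_le_right _ _))
  have hu0 := ne_zero_of_mem_petalSector hk hz.1
  have hzn := norm_le_of_mem_basinOver hz
  have hcone : fatou A k (mon α z) ∈ cone 0 τ := by
    have := ((mem_petalSector_iff hA hk hv hδ).mp hz.1).1
    exact ⟨lt_trans (by positivity) this.1, this.2⟩
  obtain ⟨h3, h4⟩ := hsec v hv δ hδ _ _ hz.1 (hzr.trans_le (min_le_left _ _))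
    (h1 hu0 z rfl hzn)
  exact ⟨⟨h3, fun i => h2 i hu0 hcone z rfl hzn⟩, h4⟩

/-! ### From invariant sets to basins -/

/-- All coordinates get the modulus |u|^(1/|α|) and a single one, with α_i ≠ 0, carries the phase.
As β < 1/|α|, such points satisfy |z_i| < |u|^β for |u| < 1. -/
lemma exists_mon_eq {α : Fin n → ℕ} (hα : α ≠ 0) {u : ℂ} (hu : u ≠ 0) :
    ∃ z : Fin n → ℂ, mon α z = u ∧ ∀ i, ‖z i‖ = ‖u‖ ^ ((∑ i, α i : ℕ) : ℝ)⁻¹ := by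
  classical
  obtain ⟨i₀, hi₀⟩ := Function.ne_iff.mp hα
  have hi₀ : α i₀ ≠ 0 := hi₀
  set M := ∑ i, α i with hM
  have hMpos : 0 < M := sum_pos_of_ne_zero hα
  have hu0 : 0 < ‖u‖ := norm_pos_iff.mpr hu
  set t : ℝ := ‖u‖ ^ (M : ℝ)⁻¹ with ht
  have htpos : 0 < t := by positivity
  have htM : t ^ M = ‖u‖ := Real.rpow_inv_natCast_pow hu0.le hMpos.ne'
  set ζ : ℂ := (u / ‖u‖) ^ ((α i₀ : ℂ)⁻¹) with hζ
  have hζpow : ζ ^ α i₀ = u / ‖u‖ := Complex.cpow_nat_inv_pow _ hi₀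
  have hζn : ‖ζ‖ = 1 := by
    have h1 := congrArg norm hζpow
    rw [norm_pow, norm_div, Complex.norm_real, norm_norm, div_self hu0.ne'] at h1
    exact (pow_eq_one_iff_of_nonneg (norm_nonneg _) hi₀).mp h1
  refine ⟨fun i => t * if i = i₀ then ζ else 1, ?_, fun i => ?_⟩
  · unfold mon
    simp only [mul_pow, Finset.prod_mul_distrib]
    rw [Finset.prod_pow_eq_pow_sum, Finset.prod_eq_single i₀]
    · rw [if_pos rfl, hζpow, ← hM, ← Complex.ofReal_pow, htM]
      have : (‖u‖ : ℂ) ≠ 0 := by simpa using hu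
      field_simp
    · intro i _ hi
      rw [if_neg hi, one_pow]
    · simp
  · rw [norm_mul, Complex.norm_real, Real.norm_of_nonneg htpos.le]
    split_ifs <;> simp [hζn]

lemma zero_mem_closure_basinOver {α : Fin n → ℕ} (hα : α ≠ 0) {β : ℝ} (hβ : 0 < β)
    (hβα : β * (∑ i, α i : ℕ) < 1) {S : Set ℂ} (hS0 : (0 : ℂ) ∉ S)
    (hS : (0 : ℂ) ∈ closure S) : (0 : Fin n → ℂ) ∈ closure (basinOver α β S) := by
  have hMpos : (0 : ℝ) < (∑ i, α i : ℕ) := by exact_mod_cast sum_pos_of_ne_zero hα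
  rw [Metric.mem_closure_iff]
  intro ρ hρ
  obtain ⟨u, hu, hur⟩ := Metric.mem_closure_iff.mp hS (min 1 (ρ ^ β⁻¹)) (by positivity)
  rw [dist_zero_left] at hur
  have hu0 : u ≠ 0 := fun h => hS0 (h ▸ hu)
  have hup : 0 < ‖u‖ := norm_pos_iff.mpr hu0
  obtain ⟨z, hz, hzn⟩ := exists_mon_eq hα hu0
  have hlt : ∀ i, ‖z i‖ < ‖mon α z‖ ^ β := by
    intro i
    rw [hzn, hz]
    refine Real.rpow_lt_rpow_of_exponent_gt hup (hur.trans_le (min_le_left _ _)) ?_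
    rwa [lt_inv_comm₀ hβ hMpos, ← one_div, lt_div_iff₀ hβ, mul_comm]
  have hmem : z ∈ basinOver α β S := ⟨by rw [hz]; exact hu, hlt⟩
  refine ⟨z, hmem, ?_⟩
  rw [dist_zero_left]
  refine (norm_le_of_mem_basinOver hmem).trans_lt ?_
  rw [hz]
  calc ‖u‖ ^ β < (ρ ^ β⁻¹) ^ β :=
        Real.rpow_lt_rpow hup.le (hur.trans_le (min_le_right _ _)) hβ
    _ = ρ := Real.rpow_inv_rpow hρ.le hβ.ne'

lemma isOpen_basinOver {α : Fin n → ℕ} {β : ℝ} (hβ : 0 < β) {S : Set ℂ} (hS : IsOpen S) :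
    IsOpen (basinOver α β S) := by
  have h1 : IsOpen (mon α ⁻¹' S) := hS.preimage (continuous_mon α)
  have h2 : IsOpen (⋂ i, {z : Fin n → ℂ | ‖z i‖ < ‖mon α z‖ ^ β}) := by
    refine isOpen_iInter_of_finite fun i => isOpen_lt (by fun_prop) ?_
    exact (continuous_mon α).norm.rpow_const fun _ => Or.inr hβ.le
  convert h1.inter h2 using 1
  ext z
  simp [basinOver]

lemma petalSector_mono {A : ℂ} {k : ℕ} {v : ℂ} (hA : A ≠ 0) (hk : 1 ≤ k)
    (hv : v ^ k = -((‖A‖ : ℂ) / A)) {τ δ δ' : ℝ} (hδ' : 0 < δ') (h : δ' ≤ δ) :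
    petalSector A k δ' (Real.arctan τ / k) v ⊆ petalSector A k δ (Real.arctan τ / k) v := by
  intro u hu
  have hδ : 0 < δ := hδ'.trans_le h
  obtain ⟨h1, h2⟩ := (mem_petalSector_iff hA hk hv hδ').mp hu
  refine (mem_petalSector_iff hA hk hv hδ).mpr ⟨⟨lt_of_le_of_lt ?_ h1.1, h1.2⟩, h2⟩
  gcongr

lemma exists_basinOver_subset_ball {A : ℂ} (hA : A ≠ 0) (k : ℕ) (α : Fin n → ℕ) {β : ℝ}
    (hβ : 0 < β) {ρ : ℝ} (hρ : 0 < ρ) :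
    ∃ δ₀ > 0, ∀ δ ≤ δ₀, ∀ (ε : ℝ) (v : ℂ),
      basinOver α β (petalSector A k δ ε v) ⊆ Metric.ball 0 ρ := by
  obtain ⟨δ₀, hδ₀, hsub⟩ := exists_petalSector_subset_ball hA k
    (show 0 < ρ ^ β⁻¹ by positivity)
  refine ⟨δ₀, hδ₀, fun δ hδ ε v z hz => ?_⟩
  rw [mem_ball_zero_iff]
  refine (norm_le_of_mem_basinOver hz).trans_lt ?_
  calc ‖mon α z‖ ^ β < (ρ ^ β⁻¹) ^ β :=
        Real.rpow_lt_rpow (norm_nonneg _) (hsub δ hδ ε v _ hz.1) hβ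
    _ = ρ := Real.rpow_inv_rpow hρ.le hβ.ne'

/-- The image of an invariant family of sets over sectors is a basin of attraction. -/
lemma isBasin_image {F G φ : (Fin n → ℂ) → (Fin n → ℂ)} {α : Fin n → ℕ} {k : ℕ} {A v : ℂ}
    {τ β δ : ℝ} (hA : A ≠ 0) (hk : 1 ≤ k) (hv : v ^ k = -((‖A‖ : ℂ) / A)) (hτ : 0 < τ)
    (hτ1 : τ ≤ 1) (hα : α ≠ 0) (hβ : 0 < β) (hβα : β * (∑ i, α i : ℕ) < 1) (hδ : 0 < δ)
    (hφ : IsGermDiffeo φ) (e : OpenPartialHomeomorph (Fin n → ℂ) (Fin n → ℂ))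
    (he : (0 : Fin n → ℂ) ∈ e.source) (heφ : ∀ z, e z = φ z)
    (hsrc : basinOver α β (petalSector A k δ (Real.arctan τ / k) v) ⊆ e.source)
    (hconj : ∀ z ∈ basinOver α β (petalSector A k δ (Real.arctan τ / k) v),
      F (φ z) = φ (G z))
    (hstep : ∀ δ', 0 < δ' → δ' ≤ δ →
      ∀ z ∈ basinOver α β (petalSector A k δ' (Real.arctan τ / k) v),
        G z ∈ basinOver α β (petalSector A k δ' (Real.arctan τ / k) v) ∧
        (fatou A k (mon α z)).re + 1 / 2 ≤ (fatou A k (mon α (G z))).re) :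
    IsBasin F (φ '' basinOver α β (petalSector A k δ (Real.arctan τ / k) v)) ∧
      (0 : Fin n → ℂ) ∈
        frontier (φ '' basinOver α β (petalSector A k δ (Real.arctan τ / k) v)) := by
  set D : ℝ → Set (Fin n → ℂ) :=
    fun δ' => basinOver α β (petalSector A k δ' (Real.arctan τ / k) v) with hD
  have hv0 := direction_ne_zero hA hk hv
  have hk' : (1 : ℝ) ≤ k := by exact_mod_cast hk
  have heq : ⇑e = φ := funext heφ
  have hSopen : IsOpen (petalSector A k δ (Real.arctan τ / k) v) := isOpen_petalSector hk hv0 (by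
    have h1 := Real.arctan_lt_pi_div_two τ
    have h2 := Real.pi_pos
    rw [div_le_iff₀ (by linarith)]
    nlinarith)
  have hUopen : IsOpen (φ '' D δ) := by
    rw [← heq]
    exact e.isOpen_image_of_subset_source (isOpen_basinOver hβ hSopen) hsrc
  have hS0 : (0 : ℂ) ∉ petalSector A k δ (Real.arctan τ / k) v :=
    fun h0 => ne_zero_of_mem_petalSector hk h0 rfl
  have hDcl : (0 : Fin n → ℂ) ∈ closure (D δ) :=
    zero_mem_closure_basinOver hα hβ hβα hS0 (zero_mem_closure_petalSector hA hk hv hτ hδ)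
  have hUcl : (0 : Fin n → ℂ) ∈ closure (φ '' D δ) := by
    have := hφ.analytic.continuousAt.continuousWithinAt.mem_closure_image hDcl
    rwa [hφ.map_zero] at this
  have h0U : (0 : Fin n → ℂ) ∉ φ '' D δ := by
    rintro ⟨z, hz, hz0⟩
    have h1 : z = 0 := by
      refine e.injOn (hsrc hz) he ?_
      rw [heφ, heφ, hz0, hφ.map_zero]
    have h2 := hz.1
    rw [h1, mon_zero hα] at h2
    exact hS0 h2
  have hmono : ∀ δ', 0 < δ' → δ' ≤ δ → D δ' ⊆ D δ := fun δ' h1 h2 =>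
    basinOver_mono (petalSector_mono hA hk hv h1 h2)
  have hit : ∀ z ∈ D δ, ∀ q : ℕ, G^[q] z ∈ D δ := fun z hz q =>
    (Set.MapsTo.iterate (fun z hz => (hstep δ hδ le_rfl z hz).1) q) hz
  have hconjit : ∀ z ∈ D δ, ∀ q : ℕ, F^[q] (φ z) = φ (G^[q] z) := by
    intro z hz q
    induction q with
    | zero => rfl
    | succ q ih =>
      rw [Function.iterate_succ_apply', ih, Function.iterate_succ_apply',
        hconj _ (hit z hz q)]
  have htend : ∀ z ∈ D δ, Tendsto (fun q : ℕ => F^[q] (φ z)) atTop (𝓝 0) := by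
    intro z hz
    have h1 : Tendsto (fun q : ℕ => mon α (G^[q] z)) atTop (𝓝 0) := by
      refine tendsto_zero_of_tendsto_fatou (k := k) hA (tendsto_atTop_of_add_half_le fun q => ?_)
      rw [Function.iterate_succ_apply']
      exact (hstep δ hδ le_rfl _ (hit z hz q)).2
    have h2 : Tendsto (fun q : ℕ => ‖mon α (G^[q] z)‖ ^ β) atTop (𝓝 0) := by
      have := h1.norm.rpow_const (p := β) (Or.inr hβ.le)
      rwa [norm_zero, Real.zero_rpow hβ.ne'] at this
    have h3 : Tendsto (fun q : ℕ => G^[q] z) atTop (𝓝 0) :=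
      squeeze_zero_norm (fun q => norm_le_of_mem_basinOver (hit z hz q)) h2
    exact (hφ.tendsto.comp h3).congr fun q => (hconjit z hz q).symm
  refine ⟨⟨hUopen, ?_, hUcl, ?_⟩, ?_⟩
  · exact closure_nonempty_iff.mp ⟨0, hUcl⟩
  · refine ⟨{Ω | Ω ∈ 𝓝 (0 : Fin n → ℂ) ∧ Set.MapsTo F (φ '' D δ ∩ Ω) (φ '' D δ ∩ Ω)}, ?_, ?_⟩
    · rw [hasBasis_iff]
      intro V
      refine ⟨fun hV => ?_, fun ⟨Ω, hΩ, hΩV⟩ => mem_of_superset hΩ.1 hΩV⟩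
      obtain ⟨ρ, hρ, hρV⟩ := Metric.mem_nhds_iff.mp (hφ.tendsto hV)
      obtain ⟨δ₀, hδ₀, hsub⟩ := exists_basinOver_subset_ball (n := n) hA k α hβ hρ
      set δ' := min δ δ₀ with hδ'def
      have hδ' : 0 < δ' := lt_min hδ hδ₀
      have hδ'le : δ' ≤ δ := min_le_left _ _
      have hDV : φ '' D δ' ⊆ V := by
        rintro _ ⟨z, hz, rfl⟩
        exact hρV (hsub δ' (min_le_right _ _) _ _ hz)
      -- The neighborhood is built so that its trace on the basin is exactly the smaller invariant
      -- set, whatever V is outside the basin.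
      have hinter : φ '' D δ ∩ (φ '' D δ' ∪ V \ φ '' D δ) = φ '' D δ' := by
        have := Set.image_mono (f := φ) (hmono δ' hδ' hδ'le)
        ext y
        constructor
        · rintro ⟨h1, h2 | h2⟩
          · exact h2
          · exact absurd h1 h2.2
        · exact fun hy => ⟨this hy, Or.inl hy⟩
      refine ⟨φ '' D δ' ∪ V \ φ '' D δ, ⟨?_, ?_⟩, ?_⟩
      -- It is a neighborhood of 0 because points of the basin close to 0 have small u and so lie
      -- over the smaller sector.
      · obtain ⟨r, hr, hmem⟩ := exists_mem_petalSector_of_norm_lt hA hk hτ1 hδ'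
        have he0 : e 0 = 0 := by rw [heφ, hφ.map_zero]
        have ht : Tendsto (fun y => ‖mon α (e.symm y)‖) (𝓝 0) (𝓝 0) := by
          have h1 : ContinuousAt e.symm 0 := by
            rw [← he0]; exact e.continuousAt_symm (e.map_source he)
          have h2 : e.symm 0 = 0 := by
            conv_lhs => rw [← he0]
            exact e.left_inv he
          have h3 : ContinuousAt (fun y => ‖mon α (e.symm y)‖) 0 :=
            (ContinuousAt.comp (g := mon α) (continuous_mon α).continuousAt h1).norm
          simpa [ContinuousAt, h2, mon_zero hα] using h3.tendsto
        filter_upwards [hV, ht.eventually_lt_const hr] with y hyV hyr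
        by_cases hy : y ∈ φ '' D δ
        · left
          obtain ⟨z, hz, rfl⟩ := hy
          rw [← heφ, e.left_inv (hsrc hz)] at hyr
          exact ⟨z, ⟨hmem v hv δ hδ _ hz.1 hyr, hz.2⟩, rfl⟩
        · exact Or.inr ⟨hyV, hy⟩
      · rw [hinter]
        rintro _ ⟨z, hz, rfl⟩
        rw [hconj z (hmono δ' hδ' hδ'le hz)]
        exact ⟨_, (hstep δ' hδ' hδ'le z hz).1, rfl⟩
      · exact Set.union_subset hDV Set.sdiff_subset
    · rintro Ω ⟨-, hΩ⟩
      refine ⟨hΩ, ?_⟩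
      rintro _ ⟨⟨z, hz, rfl⟩, -⟩
      exact htend z hz
  · rw [hUopen.frontier_eq]
    exact ⟨hUcl, h0U⟩

/-- The resonance with s = 1 reads λ_j = λ^α λ_j; cancel λ_j. -/
lemma IsOneResonant.mon_index_eq_one {F : (Fin n → ℂ) → (Fin n → ℂ)} {lam : Fin n → ℂ} {m : ℕ}
    {α : Fin n → ℕ} (hres : IsOneResonant F lam m α)
    (hlam : ∀ j : Fin n, (j : ℕ) < m → lam j ≠ 0) : mon α lam = 1 := by
  have h1 := hres.one_le
  have h2 := hres.le_dim
  set j : Fin n := ⟨0, by omega⟩ with hj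
  have hjm : (j : ℕ) < m := by simp only [hj]; omega
  have h3 := ((hres.resonance_iff j hjm _).mpr ⟨1, le_rfl, rfl⟩).2
  rw [mon_add_single, pow_one] at h3
  exact mul_right_cancel₀ (hlam j hjm) (by rw [one_mul]; exact h3.symm)

/-- Finitely many conditions, each true for all sufficiently small positive numbers. -/
lemma exists_aperture_and_exponent {ι : Type*} [Finite ι] (b : ι → ℂ) (s : Set ι)
    (hb : ∀ j ∈ s, 0 < (b j).re) (M : ℕ) :
    ∃ τ β : ℝ, 0 < τ ∧ τ ≤ 1 ∧ 0 < β ∧ β < 1 ∧ β * M < 1 ∧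
      ∀ j ∈ s, τ * |(b j).im| ≤ (b j).re / 2 ∧ β ≤ (b j).re / 4 := by
  have hlin : ∀ c d : ℝ, 0 < d → ∀ᶠ x in 𝓝[>] (0 : ℝ), x * c < d := by
    intro c d hd
    have h1 : Tendsto (fun x : ℝ => x * c) (𝓝 0) (𝓝 0) := by
      have : Continuous fun x : ℝ => x * c := by fun_prop
      simpa using this.tendsto 0
    exact (h1.eventually_lt_const hd).filter_mono nhdsWithin_le_nhds
  have hpos : ∀ᶠ x in 𝓝[>] (0 : ℝ), 0 < x := self_mem_nhdsWithin
  have h1 : ∀ᶠ x in 𝓝[>] (0 : ℝ), ∀ j, j ∈ s → x * |(b j).im| ≤ (b j).re / 2 := by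
    refine eventually_all.mpr fun j => ?_
    by_cases hj : j ∈ s
    · filter_upwards [hlin |(b j).im| _ (half_pos (hb j hj))] with x hx _ using hx.le
    · exact Eventually.of_forall fun x h => absurd h hj
  have h2 : ∀ᶠ x in 𝓝[>] (0 : ℝ), ∀ j, j ∈ s → x ≤ (b j).re / 4 := by
    refine eventually_all.mpr fun j => ?_
    by_cases hj : j ∈ s
    · have := hb j hj
      filter_upwards [hlin 1 ((b j).re / 4) (by positivity)] with x hx _
      linarith
    · exact Eventually.of_forall fun x h => absurd h hj
  obtain ⟨τ, ⟨hτ, hτ1⟩, hτs⟩ := ((hpos.and (hlin 1 1 one_pos)).and h1).exists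
  obtain ⟨β, ⟨⟨hβ, hβ1⟩, hβM⟩, hβs⟩ :=
    (((hpos.and (hlin 1 1 one_pos)).and (hlin M 1 one_pos)).and h2).exists
  exact ⟨τ, β, hτ, by linarith, hβ, by linarith, hβM, fun j hj => ⟨hτs j hj, hβs j hj⟩⟩

end

end OneRes

/-! ### Assembly -/

theorem theorem1p1 {n : ℕ} (F : (Fin n → ℂ) → (Fin n → ℂ)) (lam : Fin n → ℂ)
    (m : ℕ) (α : Fin n → ℕ) (k : ℕ) (a : Fin n → ℂ)
    (hF : OneRes.IsGermDiffeo F)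
    (hres : OneRes.IsOneResonant F lam m α)
    (hord : OneRes.HasOrder F lam m α k a)
    (hnondeg : OneRes.bigLam lam m α a ≠ 0)
    (hpar : OneRes.IsParabolicallyAttracting lam m α a)
    (hattr : ∀ j : Fin n, m ≤ (j : ℕ) → ‖lam j‖ < 1) :
    ∃ B : Fin k → Set (Fin n → ℂ),
      Pairwise (fun i j => Disjoint (B i) (B j)) ∧
      (∀ j, OneRes.IsBasin F (B j) ∧ (0 : Fin n → ℂ) ∈ frontier (B j)) ∧
      OneRes.BuiltOverPetals F lam m α k a B := by
  open OneRes in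
  have hk : 1 ≤ k := by
    obtain ⟨_, _, _, h⟩ := hord
    exact h.one_le
  have hk' : (1 : ℝ) ≤ k := by exact_mod_cast hk
  have hα := hres.index_ne_zero
  have hlam : ∀ j : Fin n, (j : ℕ) < m → lam j ≠ 0 := by
    intro j hj h0
    have := (hpar j hj).1
    rw [h0, norm_zero] at this
    exact zero_ne_one this
  set A : ℂ := bigLam lam m α a with hAdef
  obtain ⟨τ, β, hτ, hτ1, hβ, hβ1, hβα, hτβ⟩ := exists_aperture_and_exponent
    (fun j => a j * (lam j)⁻¹ * A⁻¹) {j : Fin n | (j : ℕ) < m} (fun j hj => (hpar j hj).2)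
    (∑ i, α i)
  -- β depends only on a, λ and α, which the normalization does not change; so N can be chosen after
  -- β, and the coordinates after N.
  obtain ⟨N, hN⟩ := exists_nat_gt (((k : ℝ) + 1) / β)
  rw [div_lt_iff₀ hβ, mul_comm] at hN
  obtain ⟨φ, G, p, hconj, hG, hnorm⟩ := exists_normal hα
    (fun j hj l => (hres.resonance_iff j hj l).mp) hord N
  have hexp := inducedGerm_expansion (a := a) hk p hres.index_supp hlam
    (hres.mon_index_eq_one hlam)
  set h : ℂ → ℂ := inducedGerm lam a α k p with hh
  have hGh := hnorm.mon_comp hG.diffeo hres.index_supp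
  have hexp' : (fun u : ℂ => h u - (u + A * u ^ (k + 1))) =o[𝓝 0] fun u => ‖u‖ ^ (k + 1) :=
    hexp.trans_isLittleO (isLittleO_norm_pow_norm_pow (by omega))
  obtain ⟨r, hr, hstep⟩ := exists_basin_step hnondeg hk hτ hτ1 hβ hβ1 hN hG hnorm hexp' hGh
    (fun j hj => ⟨(hpar j hj).1, (hpar j hj).2, hτβ j hj⟩) hattr
  obtain ⟨δ₁, hδ₁, hpetal⟩ := exists_isAttractingPetal hnondeg hk hτ hτ1
    (analyticAt_inducedGerm lam a α k p) hexp'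
  obtain ⟨e, he, heφ, -⟩ := exists_openPartialHomeomorph hconj.diffeo
  set W : Set (Fin n → ℂ) := e.source ∩ {z | AnalyticAt ℂ φ z} with hW
  have hWopen : IsOpen W := e.open_source.inter (isOpen_analyticAt ℂ φ)
  have hW0 : (0 : Fin n → ℂ) ∈ W := ⟨he, hconj.diffeo.analytic⟩
  obtain ⟨ρ, hρ, hball⟩ := Metric.eventually_nhds_iff.mp
    (hconj.conj.and (hWopen.mem_nhds hW0))
  obtain ⟨δ₂, hδ₂, hsub⟩ := exists_basinOver_subset_ball hnondeg k α hβ hρ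
  obtain ⟨δ₃, hδ₃, hsec⟩ := exists_petalSector_subset_ball hnondeg k hr
  -- Three demands: the sector is a petal for h, the set over it lies in the chart where the
  -- conjugacy holds, and u stays within the radius of the invariance step.
  set δ : ℝ := min δ₁ (min δ₂ δ₃) with hδdef
  have hδ : 0 < δ := by positivity
  have hle₁ : δ ≤ δ₁ := min_le_left _ _
  have hle₂ : δ ≤ δ₂ := (min_le_right _ _).trans (min_le_left _ _)
  have hle₃ : δ ≤ δ₃ := (min_le_right _ _).trans (min_le_right _ _)
  obtain ⟨v, hvinj, hv⟩ := exists_injective_roots hk (c := -((‖A‖ : ℂ) / A))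
    (neg_ne_zero.mpr (div_ne_zero (by simpa using hnondeg) hnondeg))
  set S : Fin k → Set ℂ := fun j => petalSector A k δ (Real.arctan τ / k) (v j) with hS
  have hin : ∀ j, ∀ z ∈ basinOver α β (S j), F (φ z) = φ (G z) ∧ z ∈ W := by
    intro j z hz
    exact hball (by simpa using hsub δ hle₂ _ _ hz)
  have hinj : Set.InjOn φ W := by
    have := e.injOn.mono (Set.inter_subset_left : W ⊆ e.source)
    rwa [show ⇑e = φ from funext heφ] at this
  refine ⟨fun j => φ '' basinOver α β (S j), ?_, fun j => ?_, ?_⟩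
  · intro i j hij
    refine Set.disjoint_left.mpr ?_
    rintro _ ⟨z, hz, rfl⟩ ⟨w, hw, hwz⟩
    have h1 : w = z := hinj (hin j w hw).2 (hin i z hz).2 hwz
    subst h1
    exact Set.disjoint_left.mp (disjoint_petalSector hnondeg hk (hv i) (hv j)
      (hvinj.ne hij) hδ) hz.1 hw.1
  · refine isBasin_image (G := G) hnondeg hk (hv j) hτ hτ1 hα hβ hβα hδ hconj.diffeo e he heφ
      (fun z hz => (hin j z hz).2.1) (fun z hz => (hin j z hz).1) ?_
    intro δ' hδ' hδ'le z hz
    exact hstep (v j) (hv j) δ' hδ' z hz (hsec δ' (hδ'le.trans hle₃) _ _ _ hz.1)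
  -- The sectors themselves serve as the petals P_j.
  · refine ⟨φ, G, W, h, N, β, δ, Real.arctan τ / k, v, S, hconj, hG, hWopen, hW0,
      fun z hz => hz.2, hinj, analyticAt_inducedGerm lam a α k p 0, hexp, hGh, hβ, hβα, hN, hδ,
      ?_, hvinj, hv, fun j => hpetal δ hδ hle₁ (v j) (hv j), fun j => subset_rfl,
      fun j z hz => (hin j z hz).2, fun j => rfl⟩
    have := Real.arctan_pos.mpr hτ
    positivity
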